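/- **Setting.** Let $(X,\nu)$ be a $\sigma$-finite measure space of states (for example $\mathbb R^{d}$ with Lebesgue measure) and $(Y,\rho)$ a measure space of observations. A state-space model is given by probability densities $p(x_0)$, $p(x_s\mid x_{s-1})$ with respect to $\nu$ and $p(y_s\mid x_s)$ with respect to $\rho$, for $s\ge 1$ (they may depend on $s$). A proposal is given by probability densities $r_0(x_0)$ and $r_s(x_s\mid x_{s-1},y_s)$. Fix observations $y_1,y_2,\dots$ and a time $t\ge 1$. Let $$p(y_{1:s})=\int p(x_0)\prod_{j=1}^{s}p(x_j\mid x_{j-1})\,p(y_j\mid x_j)\,dx_{0:s},$$ and let $p(y_t\mid y_{1:t-1})=\int p(y_t\mid x_t)\,p(x_t\mid y_{1:t-1})\,dx_t$ be the normalization constant of the filtering distribution, where the filtering densities are defined recursively by $p(x_s\mid y_{1:s-1})=\int p(x_s\mid x_{s-1})\,p(x_{s-1}\mid y_{1:s-1})\,dx_{s-1}$ and $p(x_s\mid y_{1:s})\propto p(y_s\mid x_s)\,p(x_s\mid y_{1:s-1})$. Assume that $p(y_{1:s})<\infty$ for all $s\le t$ and that the proposal has the right support: almost everywhere, $r_0(x_0)>0$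 iff $p(x_0)>0$, and, for $1\le s\le t$ and every $x_{s-1}$, $r_s(x_s\mid x_{s-1},y_s)>0$ iff $p(x_s\mid x_{s-1})\,p(y_s\mid x_s)>0$. Sequential Monte Carlo with $N\ge 1$ particles draws $x_0^1,\dots,x_0^N$ independently from $r_0$, with weights $w_0^i=p(x_0^i)/r_0(x_0^i)$. At each time $s\ge 1$, independently for each $i$ given the past, it draws an ancestor $a_s^i\in\{1,\dots,N\}$ with $\Pr(a_s^i=j)\propto w_{s-1}^j$ and then $x_s^i\sim r_s(\cdot\mid x_{s-1}^{a_s^i},y_s)$, and it sets $$w_s^i=\frac{p(y_s\mid x_s^i)\,p(x_s^i\mid x_{s-1}^{a_s^i})}{r_s(x_s^i\mid x_{s-1}^{a_s^i},y_s)}.$$ Let $\hat p(y_s\mid y_{1:s-1})=\frac1N\sum_i w_s^i$ for $s\ge1$ and $\hat p(y_{1:s})=\prod_{j=0}^{s}\frac1N\sum_i w_j^i$ for $s\ge 0$ (the factor $j=0$ is $1$ when $r_0(x_0)=p(x_0)$). The variational gap and the filtering ELBO are $$\mathcal R_t(N)=\log p(y_{1:t-1})-\mathbb E[\log\hat p(y_{1:t-1})],\qquad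 \widetilde{\mathcal L}_t=\mathbb E[\log\hat p(y_t\mid y_{1:t-1})]-\mathcal R_t(N).$$ **Theorem (Filtering ELBO).** 1. For every $N\ge1$: if $\log\hat p(y_{1:t-1})$ is integrable, then $\mathcal R_t(N)\ge 0$; if moreover $\log\hat p(y_t\mid y_{1:t-1})$ is integrable, then $\widetilde{\mathcal L}_t\le\log p(y_t\mid y_{1:t-1})$. 2. Suppose that for $s\in\{t-1,t\}$ the negative parts of $\log\hat p(y_{1:s})$ are uniformly integrable for large $N$, that is, $$\lim_{K\to\infty}\limsup_{N\to\infty}\mathbb E\big[(-\log\hat p(y_{1:s}))\,\mathbf 1\{-\log\hat p(y_{1:s})>K\}\big]=0.$$ Then both integrability conditions of part 1 hold for all large $N$, and $\widetilde{\mathcal L}_t\to\log p(y_t\mid y_{1:t-1})$ as $N\to\infty$. 3. Suppose that the weights $w_0,\dots,w_t$, as functions of the states, are bounded from above, and that $\log\hat p(y_{1:t})$ is integrable for $N=1$. Then both integrability conditions of part 1 hold for every $N\ge1$, and $\widetilde{\mathcal L}_t\to\log p(y_t\mid y_{1:t-1})$ as $N\to\infty$. -/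

import Mathlib

open MeasureTheory Filter Topology
open scoped NNReal ENNReal

namespace SVMC

/-- A state-space model with states in `X` (reference measure `ν`) and observations in `Y`
(reference measure `ρ`), given by the initial density `p(x₀)`, the transition densities
`trans s x x' = p(x_s = x' | x_{s-1} = x)` and the observation densities
`obs s x y = p(y_s = y | x_s = x)`. The parameters of the model may change with time. -/
structure StateSpaceModel (X Y : Type*) [MeasurableSpace X] [MeasurableSpace Y]
    (ν : Measure X) (ρ : Measure Y) where
  init : X → ℝ≥0
  trans : ℕ → X → X → ℝ≥0
  obs : ℕ → X → Y → ℝ≥0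
  measurable_init : Measurable init
  measurable_trans : ∀ s, Measurable fun q : X × X => trans s q.1 q.2
  measurable_obs : ∀ s, Measurable fun q : X × Y => obs s q.1 q.2
  lintegral_init : ∫⁻ x, init x ∂ν = 1
  lintegral_trans : ∀ s x, ∫⁻ x', trans s x x' ∂ν = 1
  lintegral_obs : ∀ s x, ∫⁻ y, obs s x y ∂ρ = 1

/-- A proposal: the initial density `r₀(x₀)` and the densities
`step s x y x' = r_s(x_s = x' | x_{s-1} = x, y_s = y)`. -/
structure Proposal (X Y : Type*) [MeasurableSpace X] [MeasurableSpace Y] (ν : Measure X) where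
  init : X → ℝ≥0
  step : ℕ → X → Y → X → ℝ≥0
  measurable_init : Measurable init
  measurable_step : ∀ s, Measurable fun q : X × Y × X => step s q.1 q.2.1 q.2.2
  lintegral_init : ∫⁻ x, init x ∂ν = 1
  lintegral_step : ∀ s x y, ∫⁻ x', step s x y x' ∂ν = 1

noncomputable section

variable {X Y : Type*} [MeasurableSpace X] [MeasurableSpace Y] {ν : Measure X} {ρ : Measure Y}

/-! ### The model: marginal likelihood and filtering recursion -/

/-- The joint density `p(x_{0:t}, y_{1:t})`. -/
def jointDensity (M : StateSpaceModel X Y ν ρ) (y : ℕ → Y) (t : ℕ) (x : Fin (t + 1) → X) : ℝ≥0 :=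
  M.init (x 0) * ∏ s : Fin t,
    (M.trans (s + 1) (x s.castSucc) (x s.succ) * M.obs (s + 1) (x s.succ) (y (s + 1)))

/-- The marginal likelihood `p(y_{1:t}) = ∫ p(x_{0:t}, y_{1:t}) dx_{0:t}`; it is `1` at `t = 0`. -/
def marginalLikelihood (M : StateSpaceModel X Y ν ρ) (y : ℕ → Y) (t : ℕ) : ℝ≥0∞ :=
  ∫⁻ x : Fin (t + 1) → X, jointDensity M y t x ∂(Measure.pi fun _ => ν)

/-- The prediction `p(x_s | y_{1:s-1}) = ∫ p(x_s | x_{s-1}) p(x_{s-1} | y_{1:s-1}) dx_{s-1}`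
computed from `prev = p(x_{s-1} | y_{1:s-1})`. -/
def predictive (M : StateSpaceModel X Y ν ρ) (s : ℕ) (prev : X → ℝ≥0∞) (x : X) : ℝ≥0∞ :=
  ∫⁻ x', M.trans s x' x * prev x' ∂ν

/-- The density of the filtering distribution `p(x_s | y_{1:s})`: it is `p(x₀)` at `s = 0`, and
`p(y_s | x_s) p(x_s | y_{1:s-1})` divided by its integral afterwards. -/
def filtering (M : StateSpaceModel X Y ν ρ) (y : ℕ → Y) : ℕ → X → ℝ≥0∞
  | 0 => fun x => M.init x
  | s + 1 => fun x =>
      M.obs (s + 1) x (y (s + 1)) * predictive M (s + 1) (filtering M y s) x /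
        ∫⁻ x', M.obs (s + 1) x' (y (s + 1)) * predictive M (s + 1) (filtering M y s) x' ∂ν

/-- The normalization constant `p(y_t | y_{1:t-1}) = ∫ p(y_t | x_t) p(x_t | y_{1:t-1}) dx_t` of the
filtering distribution at time `t ≥ 1`. -/
def filteringNormalizer (M : StateSpaceModel X Y ν ρ) (y : ℕ → Y) (t : ℕ) : ℝ≥0∞ :=
  ∫⁻ x, M.obs t x (y t) * predictive M t (filtering M y (t - 1)) x ∂ν

/-! ### Sequential Monte Carlo -/

/-- The initial importance weight `w₀ = p(x₀) / r₀(x₀)`. -/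
def initWeight (M : StateSpaceModel X Y ν ρ) (r : Proposal X Y ν) (x : X) : ℝ≥0 :=
  M.init x / r.init x

/-- The importance weight
`w_s = p(y_s | x_s) p(x_s | x_{s-1}) / r_s(x_s | x_{s-1}, y_s)` with `x = x_{s-1}`, `x' = x_s`. -/
def stepWeight (M : StateSpaceModel X Y ν ρ) (r : Proposal X Y ν) (y : ℕ → Y) (s : ℕ)
    (x x' : X) : ℝ≥0 :=
  M.obs s x' (y s) * M.trans s x x' / r.step s x (y s) x'

/-- The proposal has the same support as the density it targets: almost everywhere, `r₀(x₀) > 0` iff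
`p(x₀) > 0`, and `r_s(x_s | x_{s-1}, y_s) > 0` iff `p(x_s | x_{s-1}) p(y_s | x_s) > 0`
for `1 ≤ s ≤ t`. -/
def SameSupport (M : StateSpaceModel X Y ν ρ) (r : Proposal X Y ν) (y : ℕ → Y) (t : ℕ) : Prop :=
  (∀ᵐ x ∂ν, 0 < r.init x ↔ 0 < M.init x) ∧
  ∀ s, 1 ≤ s → s ≤ t → ∀ x, ∀ᵐ x' ∂ν,
    0 < r.step s x (y s) x' ↔ 0 < M.obs s x' (y s) * M.trans s x x'

/-- One generation of `N` particles: the states `x^i` together with their weights `w^i`. -/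
abbrev Generation (X : Type*) (N : ℕ) := Fin N → X × ℝ≥0

/-- `(1 / N) ∑ i, w^i`. -/
def meanWeight {N : ℕ} (g : Generation X N) : ℝ≥0 := (∑ i, (g i).2) / N

/-- The probability of choosing `j` as an ancestor, proportional to `w^j` (and uniform in the
degenerate case in which all weights vanish). -/
def ancestorProb {N : ℕ} (g : Generation X N) (j : Fin N) : ℝ≥0 :=
  if ∑ k, (g k).2 = 0 then 1 / N else (g j).2 / ∑ k, (g k).2

/-- The law of one initial particle: `x₀ ∼ r₀`, weighted by `w₀`. -/
def initParticleLaw (M : StateSpaceModel X Y ν ρ) (r : Proposal X Y ν) : Measure (X × ℝ≥0) :=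
  (ν.withDensity fun x => r.init x).map fun x => (x, initWeight M r x)

/-- The law of one particle at time `s` given the generation `g` at time `s - 1`: an ancestor `j` is
drawn with probability `ancestorProb g j`, then `x_s ∼ r_s(· | x_{s-1}^j, y_s)`, and the particle is
weighted by `w_s`. -/
def stepParticleLaw (M : StateSpaceModel X Y ν ρ) (r : Proposal X Y ν) (y : ℕ → Y) {N : ℕ}
    (s : ℕ) (g : Generation X N) : Measure (X × ℝ≥0) :=
  ∑ j, ancestorProb g j •
    (ν.withDensity fun x' => r.step s (g j).1 (y s) x').map
      fun x' => (x', stepWeight M r y s (g j).1 x')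

/-- The law of the generations at the times `0, …, t` of a run of sequential Monte Carlo with `N`
particles: the particles of a generation are independent given the earlier generations. -/
def smcLaw (M : StateSpaceModel X Y ν ρ) (r : Proposal X Y ν) (y : ℕ → Y) (N : ℕ) :
    (t : ℕ) → Measure (Fin (t + 1) → Generation X N)
  | 0 => (Measure.pi fun _ : Fin N => initParticleLaw M r).map fun g _ => g
  | t + 1 => (smcLaw M r y N t).bind fun h =>
      (Measure.pi fun _ : Fin N => stepParticleLaw M r y (t + 1) (h (Fin.last t))).map
        fun g => Fin.snoc (α := fun _ => Generation X N) h g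

/-- `p̂(y_{1:t}) = ∏_{s ≤ t} (1 / N) ∑ i, w_s^i`, as a function of the run. -/
def marginalEstimate {N t : ℕ} (h : Fin (t + 1) → Generation X N) : ℝ :=
  ∏ s, (meanWeight (h s) : ℝ)

/-- `p̂(y_t | y_{1:t-1}) = (1 / N) ∑ i, w_t^i`, as a function of the run. -/
def filterEstimate {N t : ℕ} (h : Fin (t + 1) → Generation X N) : ℝ :=
  meanWeight (h (Fin.last t))

/-- The variational gap `R_t(N) = log p(y_{1:t-1}) - E[log p̂(y_{1:t-1})]`, for `t ≥ 1`. -/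
def variationalGap (M : StateSpaceModel X Y ν ρ) (r : Proposal X Y ν) (y : ℕ → Y)
    (t N : ℕ) : ℝ :=
  Real.log (marginalLikelihood M y (t - 1)).toReal -
    ∫ h, Real.log (marginalEstimate h) ∂(smcLaw M r y N (t - 1))

/-- The filtering ELBO `E[log p̂(y_t | y_{1:t-1})] - R_t(N)`, for `t ≥ 1`. -/
def filteringELBO (M : StateSpaceModel X Y ν ρ) (r : Proposal X Y ν) (y : ℕ → Y)
    (t N : ℕ) : ℝ :=
  (∫ h, Real.log (filterEstimate h) ∂(smcLaw M r y N t)) - variationalGap M r y t N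

/-- The expectation `E[log p̂(y_{1:s})]` for `N` particles exists and is finite. -/
def LogMarginalIntegrable (M : StateSpaceModel X Y ν ρ) (r : Proposal X Y ν) (y : ℕ → Y)
    (s N : ℕ) : Prop :=
  Integrable (fun h => Real.log (marginalEstimate h)) (smcLaw M r y N s)

/-- The expectation `E[log p̂(y_s | y_{1:s-1})]` for `N` particles exists and is finite. -/
def LogFilterIntegrable (M : StateSpaceModel X Y ν ρ) (r : Proposal X Y ν) (y : ℕ → Y)
    (s N : ℕ) : Prop :=
  Integrable (fun h => Real.log (filterEstimate h)) (smcLaw M r y N s)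

/-- The negative parts of `log p̂(y_{1:s})` are uniformly integrable for large `N`. -/
def LogNegUniformIntegrable (M : StateSpaceModel X Y ν ρ) (r : Proposal X Y ν) (y : ℕ → Y)
    (s : ℕ) : Prop :=
  ∀ ε : ℝ≥0, 0 < ε → ∃ K : ℝ≥0, ∀ᶠ N : ℕ in atTop,
    ∫⁻ h in {h | (K : ℝ) < -Real.log (marginalEstimate h)},
      ENNReal.ofReal (-Real.log (marginalEstimate h)) ∂(smcLaw M r y N s) ≤ ε

/-- The importance weights at the times `0, …, t` are bounded from above. -/
def BoundedWeights (M : StateSpaceModel X Y ν ρ) (r : Proposal X Y ν) (y : ℕ → Y)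
    (t : ℕ) : Prop :=
  ∃ C : ℝ≥0, (∀ x, initWeight M r x ≤ C) ∧
    ∀ s, 1 ≤ s → s ≤ t → ∀ x x', stepWeight M r y s x x' ≤ C

end

end SVMC

/-!
The proof rests on two facts about the particle system. Write `K_s` for the proposal at time `s`,
acting on pairs of a state and a weight, and let `μ_s` (`weightedLaw`) be the unnormalized law
obtained by moving particles with `K_s` and multiplying by the weight at every step.

*Unbiasedness.* Multiplying by the mean weight of a generation cancels the normalization of the
ancestor probabilities (`meanWeight_mul_lintegral_stepParticleLaw`), so the product of the earlier
mean weights times the empirical mean of a test function `φ` has expectation `μ_s φ`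
(`lintegral_weightedMean`). The support condition identifies `∫ w dμ_s` with `p(y_{1:s})`, hence `E
p̂(y_{1:s}) = p(y_{1:s})` (`lintegral_marginalEstimate`), and makes all weights positive almost
surely. As `log p̂(y_t | y_{1:t-1}) + log p̂(y_{1:t-1}) = log p̂(y_{1:t})` and the normalizer of
the filtering recursion is `p(y_{1:t}) / p(y_{1:t-1})`, the filtering ELBO equals `E log
p̂(y_{1:t}) - log p(y_{1:t-1})` (`filteringELBO_succ`). Jensen's inequality gives the bounds, and
the limit reduces to `E log p̂(y_{1:t}) → log p(y_{1:t})`.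

*Law of large numbers.* For every `φ` with `μ_s φ < ∞` the lower deviation of the estimate from
`μ_s φ` tends to `0` in `L¹` (`tendsto_lintegral_sub_weightedMean`). The induction on `s` passes
from `φ` to `w * K_s φ`; only first moments are available, so `φ` is truncated first, and the
conditional variance of a bounded test function is `O(1 / N)`. A pointwise inequality
(`log_sub_integral_log_le`) then turns the lower deviation and the uniform integrability of the
negative parts into convergence of the expected logarithms, without any need to put the runs for
different `N` on one probability space.

For bounded weights, uniform integrability has to be derived. By concavity, `-log p̂` is at most a
sum over time of mean logarithmic losses of single particles, and for one particle these losses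
follow the proposal without resampling, so their integrability there is the hypothesis for `N = 1`.
It remains to dominate the particles of a run by the proposal, uniformly in `N`
(`exists_lintegral_empiricalMean_le`). A resampling step multiplies by a weight divided by the sum
of the weights. This costs a constant factor unless the mean weight is close to zero, and then a
factor of at most `N`. A Chernoff bound, carried along the run by induction, shows that the
exceptional event is so rare that powers of `N` do not matter (`exists_lintegral_indicator_le`).
-/

namespace SVMC

/-! ### Independent particles with a common law -/

section PowerMeasure

open ProbabilityTheory

variable {E F : Type*} [MeasurableSpace E] [MeasurableSpace F]

theorem measurable_measure_pi {ι : Type*} [Fintype ι] {κ : F → Measure E}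
    [∀ a, IsProbabilityMeasure (κ a)] (hκ : Measurable κ) :
    Measurable fun a => Measure.pi fun _ : ι => κ a := by
  refine Measurable.measure_of_isPiSystem_of_isProbabilityMeasure generateFrom_pi.symm
    isPiSystem_pi ?_
  rintro _ ⟨s, hs, rfl⟩
  simp only [Measure.pi_pi]
  exact Finset.measurable_prod _ fun i _ =>
    (Measure.measurable_coe (hs i (Set.mem_univ i))).comp hκ

/-- The empirical mean `(1 / N) ∑ i, φ (e i)` of a test function with values in `[0, ∞]`. -/
noncomputable def empiricalMean (φ : E → ℝ≥0∞) {N : ℕ} (e : Fin N → E) : ℝ≥0∞ :=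
  (∑ i, φ (e i)) / N

theorem measurable_empiricalMean {φ : E → ℝ≥0∞} (hφ : Measurable φ) {N : ℕ} :
    Measurable fun e : Fin N → E => empiricalMean φ e := by
  unfold empiricalMean
  fun_prop

theorem empiricalMean_mono {E : Type*} {φ ψ : E → ℝ≥0∞} (h : ∀ x, φ x ≤ ψ x) {N : ℕ}
    (e : Fin N → E) :
    empiricalMean φ e ≤ empiricalMean ψ e :=
  ENNReal.div_le_div_right (Finset.sum_le_sum fun i _ => h (e i)) _

theorem lintegral_empiricalMean (m : Measure E) [IsProbabilityMeasure m] {φ : E → ℝ≥0∞}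
    (hφ : Measurable φ) (N : ℕ) [NeZero N] :
    ∫⁻ e, empiricalMean φ e ∂(Measure.pi fun _ : Fin N => m) = ∫⁻ x, φ x ∂m := by
  simp only [empiricalMean, div_eq_mul_inv]
  rw [lintegral_mul_const _ (by fun_prop), lintegral_finsetSum _ fun i _ => by fun_prop]
  have h : ∀ i : Fin N, ∫⁻ e, φ (e i) ∂(Measure.pi fun _ : Fin N => m) = ∫⁻ x, φ x ∂m :=
    fun i => (measurePreserving_eval (fun _ : Fin N => m) i).lintegral_comp hφ
  simp only [h, Finset.sum_const, Finset.card_univ, Fintype.card_fin, nsmul_eq_mul]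
  rw [mul_comm, ← mul_assoc, ENNReal.inv_mul_cancel (by exact_mod_cast NeZero.ne N) (by simp),
    one_mul]

theorem lintegral_pi_prod {ι : Type*} [Fintype ι] (m : Measure E) [IsProbabilityMeasure m]
    {f : ι → E → ℝ≥0∞} (hf : ∀ i, Measurable (f i)) :
    ∫⁻ e, ∏ i, f i (e i) ∂(Measure.pi fun _ : ι => m) = ∏ i, ∫⁻ x, f i x ∂m := by
  rw [lintegral_prod_eq_prod_lintegral_of_indepFun Finset.univ (fun i (e : ι → E) => f i (e i))
    (iIndepFun_pi fun i => (hf i).aemeasurable) fun i => by have := hf i; fun_prop]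
  exact Finset.prod_congr rfl fun i _ =>
    (measurePreserving_eval (fun _ : ι => m) i).lintegral_comp (hf i)

/-- The weak law of large numbers in quantitative `L¹` form, for the lower deviation. -/
theorem lintegral_sub_empiricalMean_le (m : Measure E) [IsProbabilityMeasure m] {φ : E → ℝ≥0∞}
    (hφ : Measurable φ) {C : ℝ≥0} (hC : ∀ x, φ x ≤ C) (N : ℕ) [NeZero N] :
    ∫⁻ e, (∫⁻ x, φ x ∂m - empiricalMean φ e) ∂(Measure.pi fun _ : Fin N => m) ≤
      ENNReal.ofReal ((1 + C ^ 2) / √N) := by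
  set f : E → ℝ := fun x => (φ x).toReal with hf
  have hfm : Measurable f := hφ.ennreal_toReal
  have hφf : ∀ x, φ x = ENNReal.ofReal (f x) := fun x =>
    (ENNReal.ofReal_toReal (ne_top_of_le_ne_top ENNReal.coe_ne_top (hC x))).symm
  have hf0 : ∀ x, 0 ≤ f x := fun x => ENNReal.toReal_nonneg
  have hfC : ∀ x, f x ≤ C := fun x => ENNReal.toReal_le_coe_of_le_coe (hC x)
  have hLp : MemLp f 2 m := MemLp.of_bound hfm.aestronglyMeasurable C
    (ae_of_all _ fun x => by rw [Real.norm_of_nonneg (hf0 x)]; exact hfC x)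
  have hint : Integrable f m := hLp.integrable (by norm_num)
  set a : ℝ := ∫ x, f x ∂m with ha
  have hmφ : ∫⁻ x, φ x ∂m = ENNReal.ofReal a := by
    rw [ha, ofReal_integral_eq_lintegral_ofReal hint (ae_of_all _ hf0)]
    exact lintegral_congr hφf
  set P := Measure.pi fun _ : Fin N => m with hP
  set S : (Fin N → E) → ℝ := ∑ i, fun e => f (e i) with hS
  have hN : (0 : ℝ) < N := by exact_mod_cast Nat.pos_of_ne_zero (NeZero.ne N)
  have hcomp : ∀ i : Fin N, MemLp (fun e : Fin N → E => f (e i)) 2 P := fun i =>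
    hLp.comp_measurePreserving (measurePreserving_eval (fun _ : Fin N => m) i)
  have hSLp : MemLp S 2 P := by
    rw [hS]
    exact memLp_finsetSum' _ fun i _ => hcomp i
  have hSmean : ∫ e, S e ∂P = N * a := by
    simp only [hS, Finset.sum_apply]
    rw [integral_finsetSum _ fun i _ => (hcomp i).integrable (by norm_num)]
    have : ∀ i : Fin N, ∫ e, f (e i) ∂P = a := fun i =>
      integral_comp_eval (μ := fun _ : Fin N => m) hfm.aestronglyMeasurable
    simp [this]
  have hvar : Var[S; P] ≤ N * C ^ 2 := by
    rw [hS, hP, variance_sum_pi (μ := fun _ : Fin N => m) (X := fun _ => f) fun _ => hLp]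
    have h1 : Var[f; m] ≤ ((C - 0) / 2) ^ 2 :=
      variance_le_sq_of_bounded (ae_of_all _ fun x => ⟨hf0 x, hfC x⟩) hfm.aemeasurable
    have h2 : Var[f; m] ≤ C ^ 2 := h1.trans (by nlinarith [sq_nonneg (C : ℝ)])
    simpa using mul_le_mul_of_nonneg_left h2 hN.le
  have hsq : ∫ e, (a - S e / N) ^ 2 ∂P ≤ C ^ 2 / N := by
    have h1 : ∀ e, (a - S e / N) ^ 2 = (S e - P[S]) ^ 2 * (1 / N) ^ 2 := fun e => by
      rw [hSmean]; field_simp; ring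
    simp only [h1]
    rw [integral_mul_const, ← variance_eq_integral hSLp.1.aemeasurable]
    calc Var[S; P] * (1 / (N : ℝ)) ^ 2 ≤ N * (C : ℝ) ^ 2 * (1 / (N : ℝ)) ^ 2 := by gcongr
      _ = (C : ℝ) ^ 2 / N := by field_simp
  have hsqint : Integrable (fun e => (a - S e / N) ^ 2) P := by
    have : MemLp (fun e => a - S e / N) 2 P := by
      simp only [div_eq_mul_inv]
      exact (memLp_const a).sub (hSLp.mul_const _)
    exact this.integrable_sq
  have hs : 0 < √(N : ℝ) := Real.sqrt_pos.2 hN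
  have hss : √(N : ℝ) * √N = N := Real.mul_self_sqrt hN.le
  calc ∫⁻ e, (∫⁻ x, φ x ∂m - empiricalMean φ e) ∂P
      ≤ ∫⁻ e, ENNReal.ofReal (1 / √N + (a - S e / N) ^ 2 * √N) ∂P := by
        refine lintegral_mono fun e => ?_
        have h1 : empiricalMean φ e = ENNReal.ofReal (S e / N) := by
          rw [empiricalMean, ENNReal.ofReal_div_of_pos hN, ENNReal.ofReal_natCast, hS,
            Finset.sum_apply, ENNReal.ofReal_sum_of_nonneg fun i _ => hf0 _]
          simp only [hφf]
        rw [hmφ, h1, ← ENNReal.ofReal_sub _ (div_nonneg (by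
          rw [hS, Finset.sum_apply]; exact Finset.sum_nonneg fun i _ => hf0 _) hN.le)]
        refine ENNReal.ofReal_le_ofReal ?_
        -- `2 d ≤ η + d² / η` with `η = 1 / √N`, the scale of the standard deviation
        set d := a - S e / N
        have h2 : 1 / √(N : ℝ) + d ^ 2 * √N - 2 * d = (1 - d * √N) ^ 2 / √N := by
          field_simp; ring
        have h3 : 0 ≤ (1 - d * √N) ^ 2 / √N := by positivity
        have h4 : 0 ≤ 1 / √(N : ℝ) + d ^ 2 * √N := by positivity
        linarith
    _ = ENNReal.ofReal (∫ e, (1 / √N + (a - S e / N) ^ 2 * √N) ∂P) := by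
        rw [ofReal_integral_eq_lintegral_ofReal]
        · exact (integrable_const _).add (hsqint.mul_const _)
        · exact ae_of_all _ fun e => by dsimp; positivity
    _ ≤ ENNReal.ofReal ((1 + C ^ 2) / √N) := by
        refine ENNReal.ofReal_le_ofReal ?_
        rw [integral_add (integrable_const _) (hsqint.mul_const _), integral_mul_const]
        have : C ^ 2 / (N : ℝ) * √N = C ^ 2 / √N := by
          rw [div_mul_eq_mul_div, div_eq_div_iff hN.ne' hs.ne', mul_assoc, hss]
        have h5 := mul_le_mul_of_nonneg_right hsq hs.le
        rw [this] at h5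
        simp only [integral_const, probReal_univ, smul_eq_mul, one_mul]
        rw [add_div]
        linarith

/-- A Chernoff bound weighted by an unbounded test function `g`: for particles drawn independently
from `m`, the empirical mean of `φ` is exponentially unlikely to fall below a quarter of a lower
bound `c` of `m φ`, and giving mass to `g` costs only the factor `m g`. The particle at which `g` is
evaluated is left out of the exponential estimate, which costs the factor `2`. -/
theorem lintegral_empiricalMean_indicator_le (m : Measure E) [IsProbabilityMeasure m]
    {φ g : E → ℝ≥0∞} (hφ : Measurable φ) (hg : Measurable g) (hφ1 : ∀ x, φ x ≤ 1)
    {c : ℝ} (hc1 : c ≤ 1) (hc : ENNReal.ofReal c ≤ ∫⁻ x, φ x ∂m)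
    (N : ℕ) [NeZero N] :
    ∫⁻ e, {e : Fin N → E | empiricalMean φ e < ENNReal.ofReal (c / 4)}.indicator
        (empiricalMean g) e ∂(Measure.pi fun _ : Fin N => m) ≤
      ENNReal.ofReal (2 * Real.exp (-(c / 4) * N)) * ∫⁻ x, g x ∂m := by
  set f : E → ℝ := fun x => (φ x).toReal with hf
  have hfm : Measurable f := hφ.ennreal_toReal
  have hφf : ∀ x, φ x = ENNReal.ofReal (f x) := fun x =>
    (ENNReal.ofReal_toReal (ne_top_of_le_ne_top ENNReal.one_ne_top (hφ1 x))).symm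
  have hf0 : ∀ x, 0 ≤ f x := fun x => ENNReal.toReal_nonneg
  have hf1 : ∀ x, f x ≤ 1 := fun x => by simpa using ENNReal.toReal_mono (by simp) (hφ1 x)
  have hint : Integrable f m := Integrable.of_bound hfm.aestronglyMeasurable 1
    (ae_of_all _ fun x => by rw [Real.norm_of_nonneg (hf0 x)]; exact hf1 x)
  have hN : (0 : ℝ) < N := by exact_mod_cast Nat.pos_of_ne_zero (NeZero.ne N)
  have ha : c ≤ ∫ x, f x ∂m := by
    rw [← ENNReal.ofReal_le_ofReal_iff (integral_nonneg hf0),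
      ofReal_integral_eq_lintegral_ofReal hint (ae_of_all _ hf0)]
    exact hc.trans_eq (lintegral_congr hφf)
  have hexp : ∫⁻ x, ENNReal.ofReal (Real.exp (-f x)) ∂m ≤ ENNReal.ofReal (Real.exp (-(c / 2))) := by
    calc ∫⁻ x, ENNReal.ofReal (Real.exp (-f x)) ∂m ≤ ∫⁻ x, ENNReal.ofReal (1 - f x / 2) ∂m := by
          -- `exp (-u) ≤ 1 - u / 2` on `[0, 1]`
          refine lintegral_mono fun x => ENNReal.ofReal_le_ofReal ?_
          have h1 := Real.add_one_le_exp (f x)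
          rw [Real.exp_neg, inv_le_comm₀ (Real.exp_pos _) (by linarith [hf1 x])]
          refine le_trans ?_ h1
          rw [inv_le_iff_one_le_mul₀ (by linarith [hf1 x])]
          nlinarith [hf0 x, hf1 x]
      _ = ENNReal.ofReal (1 - (∫ x, f x ∂m) / 2) := by
          rw [← ofReal_integral_eq_lintegral_ofReal]
          · rw [integral_sub (integrable_const _) (hint.div_const _), integral_div]
            simp
          · exact (integrable_const _).sub (hint.div_const _)
          · exact ae_of_all _ fun x => by dsimp; linarith [hf1 x]
      _ ≤ _ := by
          refine ENNReal.ofReal_le_ofReal ?_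
          have := Real.add_one_le_exp (-(c / 2))
          linarith
  set P := Measure.pi fun _ : Fin N => m with hP
  -- `∏ i, F k i (e i) = g (e k) * exp (-∑ i, φ (e i))`, a product of functions of single particles
  set F : Fin N → Fin N → E → ℝ≥0∞ := fun k i x =>
    (if i = k then g x else 1) * ENNReal.ofReal (Real.exp (-f x)) with hF
  have hFm : ∀ k i, Measurable (F k i) := fun k i => by
    rw [hF]
    dsimp only
    split_ifs <;> fun_prop
  have key : ∀ k, ∫⁻ e, ∏ i, F k i (e i) ∂P ≤
      (∫⁻ x, g x ∂m) * ENNReal.ofReal (Real.exp (-(c / 2) * (N - 1))) := by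
    intro k
    rw [hP, lintegral_pi_prod m (hFm k), ← Finset.mul_prod_erase _ _ (Finset.mem_univ k)]
    refine mul_le_mul' ?_ ?_
    · refine lintegral_mono fun x => ?_
      simp only [hF, if_true]
      refine mul_le_of_le_one_right' (ENNReal.ofReal_le_one.2 ?_)
      exact Real.exp_le_one_iff.2 (by linarith [hf0 x])
    · calc ∏ i ∈ Finset.univ.erase k, ∫⁻ x, F k i x ∂m
          ≤ ∏ i ∈ Finset.univ.erase k, ENNReal.ofReal (Real.exp (-(c / 2))) := by
            refine Finset.prod_le_prod' fun i hi => ?_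
            simpa only [hF, if_neg (Finset.ne_of_mem_erase hi), one_mul] using hexp
        _ = ENNReal.ofReal (Real.exp (-(c / 2) * (N - 1))) := by
            rw [Finset.prod_const, Finset.card_erase_of_mem (Finset.mem_univ k), Finset.card_univ,
              Fintype.card_fin, ← ENNReal.ofReal_pow (Real.exp_pos _).le, ← Real.exp_nat_mul,
              Nat.cast_sub (Nat.one_le_iff_ne_zero.2 (NeZero.ne N))]
            push_cast
            ring_nf
  calc _ ≤ ∫⁻ e, ENNReal.ofReal (Real.exp (c / 4 * N)) * ((∑ k, ∏ i, F k i (e i)) / N) ∂P := by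
        refine lintegral_mono fun e => ?_
        refine Set.indicator_apply_le' (fun he => ?_) fun _ => zero_le
        have h1 : ∀ k, ∏ i, F k i (e i) = g (e k) * ENNReal.ofReal (Real.exp (-∑ i, f (e i))) := by
          intro k
          simp only [hF]
          rw [Finset.prod_mul_distrib, Finset.prod_ite_eq' Finset.univ k fun i => g (e i),
            if_pos (Finset.mem_univ k), ← ENNReal.ofReal_prod_of_nonneg fun i _ =>
              (Real.exp_pos _).le, ← Real.exp_sum, Finset.sum_neg_distrib]
        simp only [h1]
        have h0 : ∀ A B D : ℝ≥0∞, A * (D * B / N) = D / N * (B * A) := fun A B D => by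
          simp only [ENNReal.div_eq_inv_mul]; ring
        rw [← Finset.sum_mul, h0, ← ENNReal.ofReal_mul (Real.exp_pos _).le, ← Real.exp_add]
        refine le_mul_of_one_le_right' ?_
        rw [ENNReal.one_le_ofReal]
        refine Real.one_le_exp ?_
        have h2 : empiricalMean φ e = ENNReal.ofReal ((∑ i, f (e i)) / N) := by
          rw [empiricalMean, ENNReal.ofReal_div_of_pos hN, ENNReal.ofReal_natCast,
            ENNReal.ofReal_sum_of_nonneg fun i _ => hf0 _]
          simp only [hφf]
        rw [Set.mem_ofPred_eq, h2] at he
        have h3 := (ENNReal.ofReal_lt_ofReal_iff'.1 he).1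
        rw [div_lt_iff₀ hN] at h3
        linarith
    _ = ENNReal.ofReal (Real.exp (c / 4 * N)) * ((∑ k, ∫⁻ e, ∏ i, F k i (e i) ∂P) / N) := by
        have hm : ∀ k, Measurable fun e : Fin N → E => ∏ i, F k i (e i) := fun k =>
          Finset.measurable_prod _ fun i _ => (hFm k i).comp (measurable_pi_apply i)
        rw [lintegral_const_mul _ (by fun_prop)]
        simp only [div_eq_mul_inv]
        rw [lintegral_mul_const _ (by fun_prop), lintegral_finsetSum _ fun k _ => hm k]
    _ ≤ ENNReal.ofReal (Real.exp (c / 4 * N)) *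
          ((∑ _k : Fin N,
            (∫⁻ x, g x ∂m) * ENNReal.ofReal (Real.exp (-(c / 2) * (N - 1)))) / N) := by
        gcongr
        exact key _
    _ = ENNReal.ofReal (Real.exp (c / 4 * N)) * ENNReal.ofReal (Real.exp (-(c / 2) * (N - 1))) *
          ∫⁻ x, g x ∂m := by
        rw [Finset.sum_const, Finset.card_univ, Fintype.card_fin, nsmul_eq_mul,
          div_eq_mul_inv (_ * _) (N : ℝ≥0∞), mul_right_comm,
          ENNReal.mul_inv_cancel (by exact_mod_cast NeZero.ne N) (by simp), one_mul]
        ring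
    _ ≤ _ := by
        gcongr
        rw [← ENNReal.ofReal_mul (Real.exp_pos _).le, ← Real.exp_add]
        refine ENNReal.ofReal_le_ofReal ?_
        have h1 : Real.exp (c / 2) ≤ 2 := by
          have h2 : Real.exp (c / 2) ^ 2 ≤ 2 ^ 2 := by
            rw [← Real.exp_nat_mul]
            calc Real.exp ((2 : ℕ) * (c / 2)) ≤ Real.exp 1 :=
                  Real.exp_le_exp.2 (by push_cast; linarith)
              _ ≤ 2 ^ 2 := by linarith [Real.exp_one_lt_d9]
          exact (pow_le_pow_iff_left₀ (Real.exp_pos _).le (by norm_num) two_ne_zero).1 h2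
        calc Real.exp (c / 4 * N + -(c / 2) * (N - 1))
            = Real.exp (c / 2) * Real.exp (-(c / 4) * N) := by rw [← Real.exp_add]; ring_nf
          _ ≤ _ := by gcongr

end PowerMeasure

variable {X Y : Type*} [MeasurableSpace X] [MeasurableSpace Y] {ν : Measure X} {ρ : Measure Y}

/-! ### The law of a single particle -/

section Kernel

variable (M : StateSpaceModel X Y ν ρ) (r : Proposal X Y ν) (y : ℕ → Y)

theorem measurable_initWeight : Measurable (initWeight M r) :=
  M.measurable_init.div r.measurable_init

theorem measurable_step_uncurry (s : ℕ) :
    Measurable fun q : X × X => r.step s q.1 (y s) q.2 :=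
  (r.measurable_step s).comp (measurable_fst.prodMk (measurable_const.prodMk measurable_snd))

theorem measurable_obs_right (s : ℕ) : Measurable fun x : X => M.obs s x (y s) :=
  (M.measurable_obs s).comp (measurable_id.prodMk measurable_const)

theorem measurable_stepWeight_uncurry (s : ℕ) :
    Measurable fun q : X × X => stepWeight M r y s q.1 q.2 :=
  (((measurable_obs_right M y s).comp measurable_snd).mul (M.measurable_trans s)).div
    (measurable_step_uncurry r y s)

theorem measurable_step_right (s : ℕ) (x : X) : Measurable fun x' => r.step s x (y s) x' :=
  (measurable_step_uncurry r y s).comp (measurable_const.prodMk measurable_id)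

theorem measurable_stepWeight_right (s : ℕ) (x : X) : Measurable (stepWeight M r y s x) :=
  (measurable_stepWeight_uncurry M r y s).comp (measurable_const.prodMk measurable_id)

/-- The law of a weighted particle at time `s` whose ancestor is in the state `x`. -/
noncomputable def particleKernel (s : ℕ) (x : X) : Measure (X × ℝ≥0) :=
  (ν.withDensity fun x' => r.step s x (y s) x').map fun x' => (x', stepWeight M r y s x x')

theorem lintegral_particleKernel (s : ℕ) (x : X) {φ : X × ℝ≥0 → ℝ≥0∞} (hφ : Measurable φ) :
    ∫⁻ p, φ p ∂(particleKernel M r y s x) =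
      ∫⁻ x', r.step s x (y s) x' * φ (x', stepWeight M r y s x x') ∂ν := by
  have h1 := measurable_stepWeight_right M r y s x
  have h2 := measurable_step_right r y s x
  rw [particleKernel, lintegral_map hφ (by fun_prop),
    lintegral_withDensity_eq_lintegral_mul _ (by fun_prop) (by fun_prop)]
  rfl

theorem lintegral_initParticleLaw {φ : X × ℝ≥0 → ℝ≥0∞} (hφ : Measurable φ) :
    ∫⁻ p, φ p ∂(initParticleLaw M r) = ∫⁻ x, r.init x * φ (x, initWeight M r x) ∂ν := by
  have h1 := measurable_initWeight M r
  have h2 := r.measurable_init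
  rw [initParticleLaw, lintegral_map hφ (by fun_prop),
    lintegral_withDensity_eq_lintegral_mul _ (by fun_prop) (by fun_prop)]
  rfl

instance isProbabilityMeasure_particleKernel (s : ℕ) (x : X) :
    IsProbabilityMeasure (particleKernel M r y s x) := by
  refine ⟨?_⟩
  rw [← lintegral_one, lintegral_particleKernel M r y s x measurable_const]
  simpa using r.lintegral_step s x (y s)

instance isProbabilityMeasure_initParticleLaw : IsProbabilityMeasure (initParticleLaw M r) := by
  refine ⟨?_⟩
  rw [← lintegral_one, lintegral_initParticleLaw M r measurable_const]
  simpa using r.lintegral_init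

theorem measurable_particleKernel [SFinite ν] (s : ℕ) : Measurable (particleKernel M r y s) := by
  refine Measure.measurable_measure.2 fun S hS => ?_
  have h : ∀ x, particleKernel M r y s x S =
      ∫⁻ x', r.step s x (y s) x' * S.indicator 1 (x', stepWeight M r y s x x') ∂ν := fun x => by
    rw [← lintegral_particleKernel M r y s x (measurable_one.indicator hS),
      lintegral_indicator_one hS]
  simp only [h]
  refine Measurable.lintegral_prod_right' (f := fun q : X × X =>
    (r.step s q.1 (y s) q.2 : ℝ≥0∞) * S.indicator 1 (q.2, stepWeight M r y s q.1 q.2)) ?_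
  have h1 := measurable_stepWeight_uncurry M r y s
  have h2 := measurable_step_uncurry r y s
  exact h2.coe_nnreal_ennreal.mul
    ((measurable_one.indicator hS).comp (measurable_snd.prodMk h1))

theorem measurable_lintegral_particleKernel [SFinite ν] (s : ℕ) {φ : X × ℝ≥0 → ℝ≥0∞}
    (hφ : Measurable φ) : Measurable fun x => ∫⁻ p, φ p ∂(particleKernel M r y s x) :=
  (Measure.measurable_lintegral hφ).comp (measurable_particleKernel M r y s)

omit [MeasurableSpace X] in
theorem sum_ancestorProb {N : ℕ} [NeZero N] (g : Generation X N) : ∑ j, ancestorProb g j = 1 := by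
  unfold ancestorProb
  split_ifs with h
  · simp [NeZero.ne N]
  · rw [← Finset.sum_div, div_self h]

theorem measurable_ancestorProb {N : ℕ} (j : Fin N) :
    Measurable fun g : Generation X N => ancestorProb g j := by
  unfold ancestorProb
  refine Measurable.ite ?_ measurable_const (by fun_prop)
  exact measurableSet_eq_fun (by fun_prop) measurable_const

omit [MeasurableSpace X] in
theorem ancestorProb_le_one {N : ℕ} [NeZero N] (g : Generation X N) (j : Fin N) :
    ancestorProb g j ≤ 1 :=
  (Finset.single_le_sum (fun _ _ => zero_le) (Finset.mem_univ j)).trans_eq (sum_ancestorProb g)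

theorem lintegral_stepParticleLaw {N : ℕ} (s : ℕ) (g : Generation X N) (φ : X × ℝ≥0 → ℝ≥0∞) :
    ∫⁻ p, φ p ∂(stepParticleLaw M r y s g) =
      ∑ j, (ancestorProb g j : ℝ≥0∞) * ∫⁻ p, φ p ∂(particleKernel M r y s (g j).1) := by
  rw [stepParticleLaw, lintegral_finsetSum_measure]
  exact Finset.sum_congr rfl fun j _ => lintegral_smul_measure _ _

instance isProbabilityMeasure_stepParticleLaw {N : ℕ} [NeZero N] (s : ℕ) (g : Generation X N) :
    IsProbabilityMeasure (stepParticleLaw M r y s g) := by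
  refine ⟨?_⟩
  rw [← lintegral_one, lintegral_stepParticleLaw]
  simpa using congrArg ((↑) : ℝ≥0 → ℝ≥0∞) (sum_ancestorProb g)

theorem measurable_lintegral_stepParticleLaw [SFinite ν] {N : ℕ} (s : ℕ) {φ : X × ℝ≥0 → ℝ≥0∞}
    (hφ : Measurable φ) :
    Measurable fun g : Generation X N => ∫⁻ p, φ p ∂(stepParticleLaw M r y s g) := by
  simp only [lintegral_stepParticleLaw]
  refine Finset.measurable_sum _ fun j _ => (measurable_ancestorProb j).coe_nnreal_ennreal.mul ?_
  exact (measurable_lintegral_particleKernel M r y s hφ).comp (by fun_prop)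

theorem measurable_stepParticleLaw [SFinite ν] {N : ℕ} (s : ℕ) :
    Measurable fun g : Generation X N => stepParticleLaw M r y s g := by
  refine Measure.measurable_measure.2 fun S hS => ?_
  have := measurable_lintegral_stepParticleLaw M r y (N := N) s (measurable_one.indicator hS)
  simpa only [lintegral_indicator_one hS] using this

/-- Multiplying by the mean weight undoes the normalization of the ancestor probabilities. If all
weights vanish, where the ancestors are uniform by convention, both sides are zero. -/
theorem meanWeight_mul_lintegral_stepParticleLaw {N : ℕ} (s : ℕ) (g : Generation X N)
    (φ : X × ℝ≥0 → ℝ≥0∞) :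
    (meanWeight g : ℝ≥0∞) * ∫⁻ p, φ p ∂(stepParticleLaw M r y s g) =
      empiricalMean (fun p => p.2 * ∫⁻ q, φ q ∂(particleKernel M r y s p.1)) g := by
  rw [lintegral_stepParticleLaw, empiricalMean]
  rcases Nat.eq_zero_or_pos N with rfl | hN
  · simp
  have hN0 : (N : ℝ≥0) ≠ 0 := by exact_mod_cast hN.ne'
  rw [Finset.mul_sum, div_eq_mul_inv, Finset.sum_mul]
  refine Finset.sum_congr rfl fun j _ => ?_
  rw [← mul_assoc, mul_right_comm ((g j).2 : ℝ≥0∞), ← ENNReal.coe_mul, ← ENNReal.coe_natCast,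
    ← ENNReal.coe_inv hN0, ← ENNReal.coe_mul]
  congr 2
  unfold meanWeight ancestorProb
  split_ifs with h
  · have hj : (g j).2 = 0 := (Finset.sum_eq_zero_iff.1 h) j (Finset.mem_univ j)
    simp [h, hj]
  · field_simp

end Kernel

/-! ### Integration along a run -/

section Run

variable (M : StateSpaceModel X Y ν ρ) (r : Proposal X Y ν) (y : ℕ → Y)

theorem measurable_snoc {G : Type*} [MeasurableSpace G] (t : ℕ) :
    Measurable fun q : (Fin (t + 1) → G) × G => Fin.snoc (α := fun _ => G) q.1 q.2 := by
  refine measurable_pi_lambda _ fun i => ?_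
  induction i using Fin.lastCases with
  | last => simpa only [Fin.snoc_last] using measurable_snd
  | cast i =>
    simp only [Fin.snoc_castSucc]
    exact (measurable_pi_apply i).comp measurable_fst

theorem measurable_snoc_right {G : Type*} [MeasurableSpace G] {t : ℕ} (h : Fin (t + 1) → G) :
    Measurable fun g : G => Fin.snoc (α := fun _ => G) h g :=
  (measurable_snoc t).comp (measurable_const.prodMk measurable_id)

/-- The transition from a run to its continuation is measurable, so that the `Measure.bind` in
`smcLaw` is not a junk value. -/
theorem measurable_smc_kernel [SFinite ν] (N : ℕ) [NeZero N] (t : ℕ) :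
    Measurable fun h : Fin (t + 1) → Generation X N =>
      (Measure.pi fun _ : Fin N => stepParticleLaw M r y (t + 1) (h (Fin.last t))).map
        fun g => Fin.snoc (α := fun _ => Generation X N) h g := by
  have hpi : Measurable fun h : Fin (t + 1) → Generation X N =>
      Measure.pi fun _ : Fin N => stepParticleLaw M r y (t + 1) (h (Fin.last t)) :=
    measurable_measure_pi ((measurable_stepParticleLaw M r y (t + 1)).comp (measurable_pi_apply _))
  refine Measure.measurable_measure.2 fun S hS => ?_
  have hs := measurable_snoc (G := Generation X N) t
  let κ : ProbabilityTheory.Kernel (Fin (t + 1) → Generation X N) (Generation X N) := ⟨_, hpi⟩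
  have : ProbabilityTheory.IsMarkovKernel κ := ⟨fun h => by
    change IsProbabilityMeasure (Measure.pi _); infer_instance⟩
  have h1 := ProbabilityTheory.Kernel.measurable_kernel_prodMk_left (κ := κ) (hs hS)
  convert h1 using 2 with h
  rw [Measure.map_apply (measurable_snoc_right h) hS]
  rfl

theorem lintegral_smcLaw_zero (N : ℕ) {F : (Fin 1 → Generation X N) → ℝ≥0∞} (hF : Measurable F) :
    ∫⁻ h, F h ∂(smcLaw M r y N 0) =
      ∫⁻ g, F (fun _ => g) ∂(Measure.pi fun _ : Fin N => initParticleLaw M r) := by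
  rw [smcLaw, lintegral_map hF (measurable_pi_lambda _ fun _ => measurable_id')]

theorem lintegral_smcLaw_succ [SFinite ν] (N : ℕ) [NeZero N] (t : ℕ)
    {F : (Fin (t + 2) → Generation X N) → ℝ≥0∞} (hF : Measurable F) :
    ∫⁻ h, F h ∂(smcLaw M r y N (t + 1)) =
      ∫⁻ h, ∫⁻ g, F (Fin.snoc (α := fun _ => Generation X N) h g)
        ∂(Measure.pi fun _ : Fin N => stepParticleLaw M r y (t + 1) (h (Fin.last t)))
        ∂(smcLaw M r y N t) := by
  rw [smcLaw, Measure.lintegral_bind (measurable_smc_kernel M r y N t).aemeasurable hF.aemeasurable]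
  refine lintegral_congr fun h => ?_
  rw [lintegral_map hF (measurable_snoc_right h)]

instance isProbabilityMeasure_smcLaw [SFinite ν] (N : ℕ) [NeZero N] (t : ℕ) :
    IsProbabilityMeasure (smcLaw M r y N t) := by
  induction t with
  | zero =>
    exact ⟨by rw [← lintegral_one, lintegral_smcLaw_zero M r y N measurable_const]; simp⟩
  | succ t ih =>
    exact ⟨by rw [← lintegral_one, lintegral_smcLaw_succ M r y N t measurable_const]; simp⟩

/-- The law of the generation at time `j` does not depend on the length of the run. -/
theorem lintegral_smcLaw_eval [SFinite ν] (N : ℕ) [NeZero N] {F : Generation X N → ℝ≥0∞}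
    (hF : Measurable F) {t : ℕ} (j : Fin (t + 1)) :
    ∫⁻ h, F (h j) ∂(smcLaw M r y N t) = ∫⁻ h, F (h (Fin.last j)) ∂(smcLaw M r y N j) := by
  induction t with
  | zero =>
    obtain rfl : j = 0 := Subsingleton.elim (α := Fin 1) _ _
    rfl
  | succ t ih =>
    induction j using Fin.lastCases with
    | last => rfl
    | cast j =>
      rw [lintegral_smcLaw_succ M r y N t (by fun_prop)]
      simpa using ih j

theorem lintegral_smcLaw_init [SFinite ν] (N : ℕ) [NeZero N] (t : ℕ)
    {F : (Fin (t + 1) → Generation X N) → ℝ≥0∞} (hF : Measurable F) :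
    ∫⁻ h, F (Fin.init h) ∂(smcLaw M r y N (t + 1)) = ∫⁻ h, F h ∂(smcLaw M r y N t) := by
  have hi : Measurable (Fin.init : (Fin (t + 2) → Generation X N) → Fin (t + 1) → Generation X N) :=
    measurable_pi_lambda _ fun i => measurable_pi_apply _
  rw [lintegral_smcLaw_succ M r y N t (F := fun h => F (Fin.init h)) (hF.comp hi)]
  simp

theorem measurePreserving_init_smcLaw [SFinite ν] (N : ℕ) [NeZero N] (t : ℕ) :
    MeasurePreserving (Fin.init : (Fin (t + 2) → Generation X N) → Fin (t + 1) → Generation X N)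
      (smcLaw M r y N (t + 1)) (smcLaw M r y N t) := by
  have hi : Measurable (Fin.init : (Fin (t + 2) → Generation X N) → Fin (t + 1) → Generation X N) :=
    measurable_pi_lambda _ fun i => measurable_pi_apply _
  refine ⟨hi, Measure.ext fun S hS => ?_⟩
  rw [Measure.map_apply hi hS, ← lintegral_indicator_one hS,
    ← lintegral_smcLaw_init M r y N t (measurable_one.indicator hS),
    ← lintegral_indicator_one (hi hS)]
  rfl

theorem lintegral_empiricalMean_smcLaw_zero (N : ℕ) [NeZero N] {φ : X × ℝ≥0 → ℝ≥0∞}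
    (hφ : Measurable φ) :
    ∫⁻ h, empiricalMean φ (h (Fin.last 0)) ∂(smcLaw M r y N 0) =
      ∫⁻ p, φ p ∂(initParticleLaw M r) := by
  have := measurable_empiricalMean hφ (N := N)
  rw [lintegral_smcLaw_zero M r y N (by fun_prop), lintegral_empiricalMean _ hφ]

theorem lintegral_empiricalMean_smcLaw_succ [SFinite ν] (N : ℕ) [NeZero N] (t : ℕ)
    {φ : X × ℝ≥0 → ℝ≥0∞} (hφ : Measurable φ) :
    ∫⁻ h, empiricalMean φ (h (Fin.last (t + 1))) ∂(smcLaw M r y N (t + 1)) =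
      ∫⁻ h, ∫⁻ p, φ p ∂(stepParticleLaw M r y (t + 1) (h (Fin.last t))) ∂(smcLaw M r y N t) := by
  have := measurable_empiricalMean hφ (N := N)
  rw [lintegral_smcLaw_succ M r y N t (by fun_prop)]
  refine lintegral_congr fun h => ?_
  simp only [Fin.snoc_last]
  exact lintegral_empiricalMean _ hφ N

/-- A property that holds almost surely for every freshly drawn particle holds almost surely for all
particles of a run. -/
theorem ae_smcLaw_forall [SFinite ν] (N : ℕ) [NeZero N] {t : ℕ} {S : Set (X × ℝ≥0)}
    (hS : MeasurableSet S) (h0 : ∀ᵐ p ∂(initParticleLaw M r), p ∈ S)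
    (h1 : ∀ s, 1 ≤ s → s ≤ t → ∀ x, ∀ᵐ p ∂(particleKernel M r y s x), p ∈ S) :
    ∀ᵐ h ∂(smcLaw M r y N t), ∀ j i, h j i ∈ S := by
  rw [ae_all_iff]
  intro j
  set φ : X × ℝ≥0 → ℝ≥0∞ := Sᶜ.indicator 1 with hφ
  have hφm : Measurable φ := measurable_one.indicator hS.compl
  have hae : ∀ m : Measure (X × ℝ≥0), (∀ᵐ p ∂m, p ∈ S) → ∫⁻ p, φ p ∂m = 0 := fun m hm => by
    rw [hφ, lintegral_indicator_one hS.compl]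
    exact hm
  have hzero : ∫⁻ h, empiricalMean φ (h j) ∂(smcLaw M r y N t) = 0 := by
    rw [lintegral_smcLaw_eval M r y N (measurable_empiricalMean hφm) j]
    obtain ⟨j, hj⟩ := j
    cases j with
    | zero =>
      rw [lintegral_empiricalMean_smcLaw_zero M r y N hφm]
      exact hae _ h0
    | succ j =>
      have hst : ∀ g : Generation X N, ∫⁻ p, φ p ∂(stepParticleLaw M r y (j + 1) g) = 0 := by
        intro g
        rw [lintegral_stepParticleLaw]
        exact Finset.sum_eq_zero fun i _ => by
          rw [hae _ (h1 (j + 1) (by omega) (by omega) _), mul_zero]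
      rw [lintegral_empiricalMean_smcLaw_succ M r y N j hφm]
      simp [hst]
  have := measurable_empiricalMean hφm (N := N)
  rw [lintegral_eq_zero_iff (by fun_prop)] at hzero
  filter_upwards [hzero] with h hh i
  simp only [empiricalMean, Pi.zero_apply, ENNReal.div_eq_zero_iff, ENNReal.natCast_ne_top,
    or_false, Finset.sum_eq_zero_iff, Finset.mem_univ, true_imp_iff] at hh
  by_contra hi
  simpa [hφ, hi] using hh i

end Run

/-! ### The forward recursion and the filtering densities -/

section Forward

variable (M : StateSpaceModel X Y ν ρ) (y : ℕ → Y)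

/-- The forward density `p(x_s, y_{1:s})`: the joint density with the states before time `s`
integrated out, computed recursively. -/
noncomputable def forwardDensity : ℕ → X → ℝ≥0∞
  | 0 => fun x => M.init x
  | s + 1 => fun x => M.obs (s + 1) x (y (s + 1)) * predictive M (s + 1) (forwardDensity s) x

theorem measurable_trans_comp {α : Type*} [MeasurableSpace α] (s : ℕ) {f g : α → X}
    (hf : Measurable f) (hg : Measurable g) : Measurable fun a => M.trans s (f a) (g a) :=
  (M.measurable_trans s).comp (hf.prodMk hg)

theorem measurable_predictive [SFinite ν] (s : ℕ) {f : X → ℝ≥0∞} (hf : Measurable f) :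
    Measurable (predictive M s f) := by
  have h1 := M.measurable_trans s
  exact Measurable.lintegral_prod_left' (f := fun q : X × X => (M.trans s q.1 q.2 : ℝ≥0∞) * f q.1)
    (by fun_prop)

theorem measurable_forwardDensity [SFinite ν] (s : ℕ) : Measurable (forwardDensity M y s) := by
  induction s with
  | zero => exact M.measurable_init.coe_nnreal_ennreal
  | succ s ih =>
    exact (measurable_obs_right M y (s + 1)).coe_nnreal_ennreal.mul
      (measurable_predictive M (s + 1) ih)

/-- Tonelli's theorem for one step of the forward recursion. -/
theorem lintegral_forwardDensity_succ [SFinite ν] (s : ℕ) {f : X → ℝ≥0∞} (hf : Measurable f) :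
    ∫⁻ x', forwardDensity M y (s + 1) x' * f x' ∂ν =
      ∫⁻ x, forwardDensity M y s x * ∫⁻ x', (M.obs (s + 1) x' (y (s + 1)) * M.trans (s + 1) x x' :
        ℝ≥0) * f x' ∂ν ∂ν := by
  have h1 := measurable_obs_right M y (s + 1)
  have h2 := M.measurable_trans (s + 1)
  have h3 := measurable_forwardDensity M y s
  calc ∫⁻ x', forwardDensity M y (s + 1) x' * f x' ∂ν
      = ∫⁻ x', ∫⁻ x, forwardDensity M y s x * ((M.obs (s + 1) x' (y (s + 1)) *
          M.trans (s + 1) x x' : ℝ≥0) * f x') ∂ν ∂ν := by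
        refine lintegral_congr fun x' => ?_
        have h4 : Measurable fun x => M.trans (s + 1) x x' :=
          h2.comp (measurable_id.prodMk measurable_const)
        simp only [forwardDensity, predictive]
        rw [mul_right_comm, ← lintegral_const_mul _ (by fun_prop)]
        refine lintegral_congr fun x => ?_
        push_cast
        ring
    _ = ∫⁻ x, ∫⁻ x', forwardDensity M y s x * ((M.obs (s + 1) x' (y (s + 1)) *
          M.trans (s + 1) x x' : ℝ≥0) * f x') ∂ν ∂ν := by
        refine lintegral_lintegral_swap (Measurable.aemeasurable ?_)
        have h4 : Measurable fun q : X × X => M.trans (s + 1) q.2 q.1 := h2.comp measurable_swap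
        simp only [Function.uncurry_def]
        fun_prop
    _ = _ := by
        refine lintegral_congr fun x => ?_
        have h4 : Measurable fun x' => M.trans (s + 1) x x' :=
          h2.comp (measurable_const.prodMk measurable_id)
        rw [lintegral_const_mul _ (by fun_prop)]

theorem jointDensity_snoc (s : ℕ) (x : Fin (s + 1) → X) (x' : X) :
    jointDensity M y (s + 1) (Fin.snoc (α := fun _ => X) x x') =
      jointDensity M y s x *
        (M.obs (s + 1) x' (y (s + 1)) * M.trans (s + 1) (x (Fin.last s)) x') := by
  have h0 : (Fin.snoc (α := fun _ => X) x x' : Fin (s + 2) → X) 0 = x 0 := by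
    rw [← Fin.castSucc_zero, Fin.snoc_castSucc]
  rw [jointDensity, jointDensity, Fin.prod_univ_castSucc, h0, ← mul_assoc]
  congr 1
  · congr 1
    refine Finset.prod_congr rfl fun j _ => ?_
    rw [Fin.snoc_castSucc, ← Fin.castSucc_succ, Fin.snoc_castSucc]
    rfl
  · rw [Fin.snoc_castSucc, Fin.succ_last, Fin.snoc_last, mul_comm]
    rfl

theorem measurable_jointDensity (s : ℕ) : Measurable (jointDensity M y s) := by
  refine (M.measurable_init.comp (measurable_pi_apply _)).mul
    (Finset.measurable_prod _ fun j _ => Measurable.mul ?_ ?_)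
  · exact measurable_trans_comp M _ (measurable_pi_apply _) (measurable_pi_apply _)
  · exact (measurable_obs_right M y _).comp (measurable_pi_apply _)

/-- Integrating the joint density over the path, last state last. -/
theorem lintegral_jointDensity_mul [SigmaFinite ν] (s : ℕ) {f : X → ℝ≥0∞} (hf : Measurable f) :
    ∫⁻ x : Fin (s + 1) → X, jointDensity M y s x * f (x (Fin.last s)) ∂(Measure.pi fun _ => ν) =
      ∫⁻ x, forwardDensity M y s x * f x ∂ν := by
  induction s generalizing f with
  | zero =>
    have h := (measurePreserving_piUnique fun _ : Fin 1 => ν).symm.lintegral_comp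
      (f := fun x : Fin 1 → X => (M.init (x 0) : ℝ≥0∞) * f (x 0)) (by
        have := M.measurable_init
        fun_prop)
    simp only [jointDensity, Finset.univ_eq_empty, Finset.prod_empty, mul_one]
    exact h.symm
  | succ s ih =>
    have h1 := measurable_obs_right M y (s + 1)
    have h2 := M.measurable_trans (s + 1)
    have h3 := measurable_jointDensity M y s
    have h4 := measurable_jointDensity M y (s + 1)
    have h := (measurePreserving_piFinSuccAbove (fun _ : Fin (s + 2) => ν)
      (Fin.last (s + 1))).symm.lintegral_comp
      (f := fun x : Fin (s + 2) → X => (jointDensity M y (s + 1) x : ℝ≥0∞) *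
        f (x (Fin.last (s + 1)))) (by fun_prop)
    rw [← h, lintegral_forwardDensity_succ M y s hf, ← ih]
    · have hsnoc : ∀ z : X × (Fin (s + 1) → X),
          (MeasurableEquiv.piFinSuccAbove (fun _ => X) (Fin.last (s + 1))).symm z =
            Fin.snoc (α := fun _ => X) z.2 z.1 := fun z => by
        simp [MeasurableEquiv.piFinSuccAbove, Fin.insertNthEquiv, Fin.insertNth_last']
      simp only [hsnoc, jointDensity_snoc, Fin.snoc_last]
      have h5 : Measurable fun q : X × (Fin (s + 1) → X) =>
          M.trans (s + 1) (q.2 (Fin.last s)) q.1 :=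
        measurable_trans_comp M _ ((measurable_pi_apply _).comp measurable_snd) measurable_fst
      rw [lintegral_prod_symm' _ (by fun_prop)]
      refine lintegral_congr fun x => ?_
      have h6 : Measurable fun x' => M.trans (s + 1) (x (Fin.last s)) x' :=
        h2.comp (measurable_const.prodMk measurable_id)
      rw [← lintegral_const_mul _ (by fun_prop)]
      refine lintegral_congr fun x' => ?_
      push_cast
      ring
    · refine Measurable.lintegral_prod_right' (f := fun q : X × X =>
        ((M.obs (s + 1) q.2 (y (s + 1)) * M.trans (s + 1) q.1 q.2 : ℝ≥0) : ℝ≥0∞) * f q.2) ?_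
      fun_prop

theorem marginalLikelihood_eq_lintegral_forwardDensity [SigmaFinite ν] (s : ℕ) :
    marginalLikelihood M y s = ∫⁻ x, forwardDensity M y s x ∂ν := by
  simpa [marginalLikelihood] using lintegral_jointDensity_mul M y s (f := fun _ => 1)
    measurable_const

theorem predictive_div [SFinite ν] (s : ℕ) {f : X → ℝ≥0∞} (hf : Measurable f) (c : ℝ≥0∞) (x : X) :
    predictive M s (fun x => f x / c) x = predictive M s f x / c := by
  have h1 : Measurable fun x' => M.trans s x' x :=
    (M.measurable_trans s).comp (measurable_id.prodMk measurable_const)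
  simp only [predictive, div_eq_mul_inv]
  rw [← lintegral_mul_const _ (by fun_prop)]
  exact lintegral_congr fun x' => (mul_assoc _ _ _).symm

/-- The normalization integral of the filtering recursion, started from the normalized forward
density. -/
theorem lintegral_obs_mul_predictive_div [SigmaFinite ν] (s : ℕ) (c : ℝ≥0∞) :
    ∫⁻ x, M.obs (s + 1) x (y (s + 1)) *
        predictive M (s + 1) (fun x => forwardDensity M y s x / c) x ∂ν =
      marginalLikelihood M y (s + 1) / c := by
  have h := measurable_forwardDensity M y (s + 1)
  simp only [predictive_div M (s + 1) (measurable_forwardDensity M y s)]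
  rw [marginalLikelihood_eq_lintegral_forwardDensity, div_eq_mul_inv, ← lintegral_mul_const _ h]
  exact lintegral_congr fun x => by rw [forwardDensity, div_eq_mul_inv, mul_assoc]

/-- The filtering density is the normalized forward density. -/
theorem filtering_eq_forwardDensity_div [SigmaFinite ν] {t : ℕ}
    (h0 : ∀ s < t, marginalLikelihood M y s ≠ 0) (hfin : ∀ s < t, marginalLikelihood M y s ≠ ∞) :
    filtering M y t = fun x => forwardDensity M y t x / marginalLikelihood M y t := by
  induction t with
  | zero =>
    have h1 : marginalLikelihood M y 0 = 1 := by
      rw [marginalLikelihood_eq_lintegral_forwardDensity]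
      exact M.lintegral_init
    funext x
    simp [h1, filtering, forwardDensity]
  | succ t ih =>
    have ih' := ih (fun s hs => h0 s (by omega)) (fun s hs => hfin s (by omega))
    funext x
    have hcancel : ∀ a b c : ℝ≥0∞, c ≠ 0 → c ≠ ∞ → a / c / (b / c) = a / b := fun a b c hc hc' => by
      rw [div_eq_mul_inv a, div_eq_mul_inv b, ENNReal.mul_div_mul_right _ _ (by simpa) (by simpa)]
    simp only [filtering]
    rw [ih', lintegral_obs_mul_predictive_div,
      predictive_div M (t + 1) (measurable_forwardDensity M y t), ← mul_div_assoc, forwardDensity,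
      hcancel _ _ _ (h0 t t.lt_succ_self) (hfin t t.lt_succ_self)]

theorem filteringNormalizer_succ [SigmaFinite ν] {t : ℕ}
    (h0 : ∀ s < t, marginalLikelihood M y s ≠ 0) (hfin : ∀ s < t, marginalLikelihood M y s ≠ ∞) :
    filteringNormalizer M y (t + 1) =
      marginalLikelihood M y (t + 1) / marginalLikelihood M y t := by
  rw [filteringNormalizer, Nat.add_sub_cancel, filtering_eq_forwardDensity_div M y h0 hfin,
    lintegral_obs_mul_predictive_div]

end Forward

/-! ### Unbiasedness -/

section Weighted

variable (M : StateSpaceModel X Y ν ρ) (r : Proposal X Y ν) (y : ℕ → Y)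

/-- The unnormalized law of a weighted particle at time `s`: the particles are moved by the
proposal, and every step multiplies the measure by the weight of the particle that is left. Its mass
is `p(y_{1:s-1})` if `s ≥ 1`, and the integral of the weight is `p(y_{1:s})`. -/
noncomputable def weightedLaw : ℕ → Measure (X × ℝ≥0)
  | 0 => initParticleLaw M r
  | s + 1 => ((weightedLaw s).withDensity fun p => p.2).bind
      fun p => particleKernel M r y (s + 1) p.1

theorem lintegral_weightedLaw_succ [SFinite ν] (s : ℕ) {φ : X × ℝ≥0 → ℝ≥0∞} (hφ : Measurable φ) :
    ∫⁻ p, φ p ∂(weightedLaw M r y (s + 1)) =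
      ∫⁻ p, p.2 * ∫⁻ q, φ q ∂(particleKernel M r y (s + 1) p.1) ∂(weightedLaw M r y s) := by
  have h : Measurable fun p : X × ℝ≥0 => particleKernel M r y (s + 1) p.1 :=
    (measurable_particleKernel M r y (s + 1)).comp measurable_fst
  have h' : Measurable fun p : X × ℝ≥0 => ∫⁻ q, φ q ∂(particleKernel M r y (s + 1) p.1) :=
    (measurable_lintegral_particleKernel M r y (s + 1) hφ).comp measurable_fst
  rw [weightedLaw, Measure.lintegral_bind h.aemeasurable hφ.aemeasurable,
    lintegral_withDensity_eq_lintegral_mul _ (by fun_prop) h']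
  rfl

theorem measurable_weight_mul_lintegral [SFinite ν] (s : ℕ) {φ : X × ℝ≥0 → ℝ≥0∞}
    (hφ : Measurable φ) :
    Measurable fun p : X × ℝ≥0 => (p.2 : ℝ≥0∞) * ∫⁻ q, φ q ∂(particleKernel M r y s p.1) :=
  measurable_snd.coe_nnreal_ennreal.mul
    ((measurable_lintegral_particleKernel M r y s hφ).comp measurable_fst)

/-- The product of the mean weights of the generations before the last one. -/
noncomputable def pastWeight {N t : ℕ} (h : Fin (t + 1) → Generation X N) : ℝ≥0 :=
  ∏ j : Fin t, meanWeight (h j.castSucc)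

/-- The estimate of the integral of `φ` against `weightedLaw` that a run provides. -/
noncomputable def weightedMean (φ : X × ℝ≥0 → ℝ≥0∞) {N t : ℕ} (h : Fin (t + 1) → Generation X N) :
    ℝ≥0∞ :=
  pastWeight h * empiricalMean φ (h (Fin.last t))

theorem measurable_meanWeight {N : ℕ} : Measurable fun g : Generation X N => meanWeight g := by
  unfold meanWeight
  fun_prop

theorem measurable_pastWeight {N t : ℕ} :
    Measurable fun h : Fin (t + 1) → Generation X N => pastWeight h :=
  Finset.measurable_prod _ fun _ _ => measurable_meanWeight.comp (measurable_pi_apply _)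

theorem measurable_weightedMean {φ : X × ℝ≥0 → ℝ≥0∞} (hφ : Measurable φ) {N t : ℕ} :
    Measurable fun h : Fin (t + 1) → Generation X N => weightedMean φ h :=
  measurable_pastWeight.coe_nnreal_ennreal.mul
    ((measurable_empiricalMean hφ).comp (measurable_pi_apply _))

omit [MeasurableSpace X] in
theorem coe_meanWeight {N : ℕ} [NeZero N] (g : Generation X N) :
    (meanWeight g : ℝ≥0∞) = empiricalMean (fun p => (p.2 : ℝ≥0∞)) g := by
  rw [meanWeight, empiricalMean, ENNReal.coe_div (by exact_mod_cast NeZero.ne N)]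
  push_cast
  rfl

omit [MeasurableSpace X] in
theorem pastWeight_snoc {N t : ℕ} (h : Fin (t + 1) → Generation X N) (g : Generation X N) :
    pastWeight (Fin.snoc (α := fun _ => Generation X N) h g : Fin (t + 2) → Generation X N) =
      pastWeight h * meanWeight (h (Fin.last t)) := by
  rw [pastWeight, pastWeight]
  simp only [Fin.snoc_castSucc]
  rw [Fin.prod_univ_castSucc]

omit [MeasurableSpace X] in
theorem ofReal_marginalEstimate {N t : ℕ} [NeZero N] (h : Fin (t + 1) → Generation X N) :
    ENNReal.ofReal (marginalEstimate h) = weightedMean (fun p => (p.2 : ℝ≥0∞)) h := by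
  rw [marginalEstimate, weightedMean, ← coe_meanWeight, ← NNReal.coe_prod,
    ENNReal.ofReal_coe_nnreal, Fin.prod_univ_castSucc, ENNReal.coe_mul, pastWeight]

theorem pastWeight_mul_lintegral_stepParticleLaw {N t : ℕ} (h : Fin (t + 1) → Generation X N)
    (φ : X × ℝ≥0 → ℝ≥0∞) (s : ℕ) :
    ((pastWeight h * meanWeight (h (Fin.last t)) : ℝ≥0) : ℝ≥0∞) *
        ∫⁻ p, φ p ∂(stepParticleLaw M r y s (h (Fin.last t))) =
      weightedMean (fun p => p.2 * ∫⁻ q, φ q ∂(particleKernel M r y s p.1)) h := by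
  rw [ENNReal.coe_mul, mul_assoc, meanWeight_mul_lintegral_stepParticleLaw, weightedMean]

/-- The estimates of sequential Monte Carlo are unbiased. -/
theorem lintegral_weightedMean [SFinite ν] (N : ℕ) [NeZero N] (t : ℕ) {φ : X × ℝ≥0 → ℝ≥0∞}
    (hφ : Measurable φ) :
    ∫⁻ h, weightedMean φ h ∂(smcLaw M r y N t) = ∫⁻ p, φ p ∂(weightedLaw M r y t) := by
  induction t generalizing φ with
  | zero =>
    rw [weightedLaw, ← lintegral_empiricalMean_smcLaw_zero M r y N hφ]
    simp [weightedMean, pastWeight]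
  | succ t ih =>
    rw [lintegral_smcLaw_succ M r y N t (measurable_weightedMean hφ),
      lintegral_weightedLaw_succ M r y t hφ,
      ← ih (measurable_weight_mul_lintegral M r y (t + 1) hφ)]
    refine lintegral_congr fun h => ?_
    simp only [weightedMean, pastWeight_snoc, Fin.snoc_last]
    rw [lintegral_const_mul _ (measurable_empiricalMean hφ), lintegral_empiricalMean _ hφ]
    exact pastWeight_mul_lintegral_stepParticleLaw M r y h φ (t + 1)

/-- Under the support condition, weighting turns the proposal into the model. -/
theorem lintegral_weight_mul_weightedLaw [SFinite ν] {t : ℕ} (hsupp : SameSupport M r y t) {s : ℕ}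
    (hs : s ≤ t) {f : X → ℝ≥0∞} (hf : Measurable f) :
    ∫⁻ p, p.2 * f p.1 ∂(weightedLaw M r y s) = ∫⁻ x, forwardDensity M y s x * f x ∂ν := by
  have hcancel : ∀ a b : ℝ≥0, (0 < a ↔ 0 < b) → ∀ c : ℝ≥0∞, (a : ℝ≥0∞) * ((b / a : ℝ≥0) * c) =
      b * c := by
    intro a b hab c
    rw [← mul_assoc, ← ENNReal.coe_mul]
    rcases eq_zero_or_pos a with rfl | ha
    · have hb : b = 0 := by simpa using hab
      simp [hb]
    · rw [mul_div_cancel₀ _ ha.ne']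
  induction s generalizing f with
  | zero =>
    rw [weightedLaw, lintegral_initParticleLaw M r (by fun_prop)]
    refine lintegral_congr_ae ?_
    filter_upwards [hsupp.1] with x hx
    exact hcancel _ _ hx _
  | succ s ih =>
    have hQ : Measurable fun x => ∫⁻ q, (q.2 : ℝ≥0∞) * f q.1 ∂(particleKernel M r y (s + 1) x) :=
      measurable_lintegral_particleKernel M r y (s + 1) (by fun_prop)
    rw [lintegral_weightedLaw_succ M r y s (by fun_prop), ih (by omega) hQ,
      lintegral_forwardDensity_succ M y s hf]
    refine lintegral_congr fun x => ?_
    rw [lintegral_particleKernel M r y (s + 1) x (by fun_prop)]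
    congr 1
    refine lintegral_congr_ae ?_
    filter_upwards [hsupp.2 (s + 1) (by omega) hs x] with x' hx'
    exact hcancel _ _ hx' _

theorem lintegral_weight_weightedLaw [SigmaFinite ν] {t : ℕ} (hsupp : SameSupport M r y t) {s : ℕ}
    (hs : s ≤ t) : ∫⁻ p, p.2 ∂(weightedLaw M r y s) = marginalLikelihood M y s := by
  rw [marginalLikelihood_eq_lintegral_forwardDensity]
  simpa using lintegral_weight_mul_weightedLaw M r y hsupp hs (f := fun _ => 1) measurable_const

/-- Unbiasedness of the estimate of the marginal likelihood. -/
theorem lintegral_marginalEstimate [SigmaFinite ν] (N : ℕ) [NeZero N] {t : ℕ}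
    (hsupp : SameSupport M r y t) {s : ℕ} (hs : s ≤ t) :
    ∫⁻ h, ENNReal.ofReal (marginalEstimate h) ∂(smcLaw M r y N s) = marginalLikelihood M y s := by
  simp only [ofReal_marginalEstimate]
  rw [lintegral_weightedMean M r y N s (by fun_prop), lintegral_weight_weightedLaw M r y hsupp hs]

/-- Under the support condition no particle ever has weight zero. -/
theorem ae_weight_pos [SFinite ν] (N : ℕ) [NeZero N] {t : ℕ} (hsupp : SameSupport M r y t) {s : ℕ}
    (hs : s ≤ t) : ∀ᵐ h ∂(smcLaw M r y N s), ∀ j i, 0 < (h j i).2 := by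
  have hpos : ∀ a b : ℝ≥0, (0 < a ↔ 0 < b) → a ≠ 0 → 0 < b / a := fun a b hab ha =>
    div_pos (hab.1 (pos_iff_ne_zero.2 ha)) (pos_iff_ne_zero.2 ha)
  have hS : MeasurableSet {p : X × ℝ≥0 | 0 < p.2} :=
    measurableSet_lt measurable_const measurable_snd
  refine ae_smcLaw_forall M r y N (S := {p | 0 < p.2}) hS ?_ fun j hj0 hjs x => ?_
  · have h1 := measurable_initWeight M r
    have h2 := r.measurable_init
    change ∀ᵐ p : X × ℝ≥0 ∂_, 0 < p.2
    rw [initParticleLaw, ae_map_iff (by fun_prop) hS, ae_withDensity_iff (by fun_prop)]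
    filter_upwards [hsupp.1] with x hx h0
    exact hpos _ _ hx (by simpa using h0)
  · have h1 := measurable_stepWeight_right M r y j x
    have h2 := measurable_step_right r y j x
    change ∀ᵐ p : X × ℝ≥0 ∂_, 0 < p.2
    rw [particleKernel, ae_map_iff (by fun_prop) hS, ae_withDensity_iff (by fun_prop)]
    filter_upwards [hsupp.2 j hj0 (hjs.trans hs) x] with x' hx' h0
    exact hpos _ _ hx' (by simpa using h0)

omit [MeasurableSpace X] in
theorem meanWeight_pos {N : ℕ} [NeZero N] {g : Generation X N} (hg : ∀ i, 0 < (g i).2) :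
    0 < meanWeight g :=
  div_pos (Finset.sum_pos (fun i _ => hg i) Finset.univ_nonempty)
    (by exact_mod_cast Nat.pos_of_ne_zero (NeZero.ne N))

theorem ae_meanWeight_pos [SFinite ν] (N : ℕ) [NeZero N] {t : ℕ} (hsupp : SameSupport M r y t)
    {s : ℕ} (hs : s ≤ t) : ∀ᵐ h ∂(smcLaw M r y N s), ∀ j, 0 < meanWeight (h j) := by
  filter_upwards [ae_weight_pos M r y N hsupp hs] with h hh j
  exact meanWeight_pos (hh j)

theorem ae_marginalEstimate_pos [SFinite ν] (N : ℕ) [NeZero N] {t : ℕ} (hsupp : SameSupport M r y t)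
    {s : ℕ} (hs : s ≤ t) : ∀ᵐ h ∂(smcLaw M r y N s), 0 < marginalEstimate h := by
  filter_upwards [ae_meanWeight_pos M r y N hsupp hs] with h hh
  exact Finset.prod_pos fun j _ => NNReal.coe_pos.2 (hh j)

theorem measurable_marginalEstimate {N t : ℕ} :
    Measurable fun h : Fin (t + 1) → Generation X N => marginalEstimate h :=
  Finset.measurable_prod _ fun _ _ =>
    (measurable_meanWeight.comp (measurable_pi_apply _)).coe_nnreal_real

/-- The estimate of the marginal likelihood is almost surely positive, and so is its expectation. -/
theorem marginalLikelihood_ne_zero [SigmaFinite ν] {t : ℕ} (hsupp : SameSupport M r y t) {s : ℕ}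
    (hs : s ≤ t) : marginalLikelihood M y s ≠ 0 := by
  rw [← lintegral_marginalEstimate M r y 1 hsupp hs, ← pos_iff_ne_zero]
  rw [lintegral_pos_iff_support (measurable_marginalEstimate (X := X)).ennreal_ofReal]
  have h1 : Function.support (fun h : Fin (s + 1) → Generation X 1 =>
      ENNReal.ofReal (marginalEstimate h)) = {h | 0 < marginalEstimate h} := by
    ext h; simp
  rw [h1, (prob_compl_eq_zero_iff₀ ?_).1 (ae_marginalEstimate_pos M r y 1 hsupp hs)]
  · simp
  · exact (measurableSet_lt measurable_const measurable_marginalEstimate).nullMeasurableSet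

end Weighted

/-! ### Expected logarithms -/

section LogLimit

variable {Ω : Type*} [MeasurableSpace Ω] {P : Measure Ω} {Z : Ω → ℝ}

theorem integrable_log_of_lintegral_ne_top [IsProbabilityMeasure P] (hZ : Measurable Z)
    (hpos : ∀ᵐ ω ∂P, 0 < Z ω) (hE : ∫⁻ ω, ENNReal.ofReal (Z ω) ∂P ≠ ∞) {K : ℝ≥0}
    (hK : ∫⁻ ω in {ω | (K : ℝ) < -Real.log (Z ω)}, ENNReal.ofReal (-Real.log (Z ω)) ∂P ≠ ∞) :
    Integrable (fun ω => Real.log (Z ω)) P := by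
  have hlog : Measurable fun ω => Real.log (Z ω) := Real.measurable_log.comp hZ
  refine ⟨hlog.aestronglyMeasurable, ?_⟩
  have hS : MeasurableSet {ω | (K : ℝ) < -Real.log (Z ω)} :=
    measurableSet_lt measurable_const hlog.neg
  rw [← lintegral_indicator hS] at hK
  refine (lintegral_mono_ae (g := fun ω => ENNReal.ofReal (Z ω) + (K +
    {ω | (K : ℝ) < -Real.log (Z ω)}.indicator (fun ω => ENNReal.ofReal (-Real.log (Z ω))) ω))
    ?_).trans_lt ?_
  · filter_upwards [hpos] with ω hω
    rw [Real.enorm_eq_ofReal_abs]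
    rcases le_or_gt 0 (Real.log (Z ω)) with h0 | h0
    · rw [abs_of_nonneg h0]
      refine le_add_right (ENNReal.ofReal_le_ofReal ?_)
      linarith [Real.log_le_sub_one_of_pos hω]
    · rw [abs_of_neg h0]
      refine le_add_left ?_
      by_cases h1 : (K : ℝ) < -Real.log (Z ω)
      · rw [Set.indicator_of_mem (by exact h1)]
        exact le_add_self
      · refine le_add_right ?_
        rw [← ENNReal.ofReal_coe_nnreal]
        exact ENNReal.ofReal_le_ofReal (not_lt.1 h1)
  · rw [lintegral_add_left (by fun_prop), lintegral_add_left (by fun_prop)]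
    simp only [lintegral_const, measure_univ, mul_one]
    exact ENNReal.add_lt_top.2 ⟨hE.lt_top, ENNReal.add_lt_top.2 ⟨ENNReal.coe_lt_top, hK.lt_top⟩⟩

/-- Jensen's inequality for the logarithm. -/
theorem integral_log_le_log [IsProbabilityMeasure P] (hZ : Measurable Z)
    (hpos : ∀ᵐ ω ∂P, 0 < Z ω) {p : ℝ} (hp : 0 < p)
    (hE : ∫⁻ ω, ENNReal.ofReal (Z ω) ∂P = ENNReal.ofReal p)
    (hint : Integrable (fun ω => Real.log (Z ω)) P) :
    ∫ ω, Real.log (Z ω) ∂P ≤ Real.log p := by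
  have hZ0 : 0 ≤ᵐ[P] Z := hpos.mono fun ω h => h.le
  have hZint : Integrable Z P :=
    (lintegral_ofReal_ne_top_iff_integrable hZ.aestronglyMeasurable hZ0).1 (by simp [hE])
  have hZE : ∫ ω, Z ω ∂P = p := by
    rw [integral_eq_lintegral_of_nonneg_ae hZ0 hZ.aestronglyMeasurable, hE,
      ENNReal.toReal_ofReal hp.le]
  calc ∫ ω, Real.log (Z ω) ∂P ≤ ∫ ω, (Z ω / p + (Real.log p - 1)) ∂P := by
        refine integral_mono_ae hint ((hZint.div_const p).add (integrable_const _)) ?_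
        filter_upwards [hpos] with ω hω
        have h := Real.log_le_sub_one_of_pos (div_pos hω hp)
        rw [Real.log_div hω.ne' hp.ne'] at h
        linarith
    _ = Real.log p := by
        rw [integral_add (hZint.div_const p) (integrable_const _), integral_div, hZE,
          div_self hp.ne']
        simp

/-- The loss of the expected logarithm against `log p` is controlled by the lower `L¹` deviation of
`Z` from `p` and the tail of the negative part of `log Z`. Where `Z ≥ p / 2`, the logarithm is
Lipschitz; elsewhere the deviation is at least `p / 2` and pays for the constant `K`. -/
theorem log_sub_integral_log_le [IsProbabilityMeasure P] (hZ : Measurable Z)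
    (hpos : ∀ᵐ ω ∂P, 0 < Z ω) {p : ℝ} (hp : 0 < p)
    (hint : Integrable (fun ω => Real.log (Z ω)) P) (K : ℝ≥0) :
    ENNReal.ofReal (Real.log p - ∫ ω, Real.log (Z ω) ∂P) ≤
      ENNReal.ofReal (2 / p * (1 + K + |Real.log p|)) * ∫⁻ ω, ENNReal.ofReal (p - Z ω) ∂P +
      ∫⁻ ω in {ω | (K : ℝ) < -Real.log (Z ω)}, ENNReal.ofReal (-Real.log (Z ω)) ∂P := by
  have hlog : Measurable fun ω => Real.log (Z ω) := Real.measurable_log.comp hZ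
  have hS : MeasurableSet {ω | (K : ℝ) < -Real.log (Z ω)} :=
    measurableSet_lt measurable_const hlog.neg
  have hint' : Integrable (fun ω => Real.log p - Real.log (Z ω)) P := (integrable_const _).sub hint
  have h1 : Real.log p - ∫ ω, Real.log (Z ω) ∂P = ∫ ω, (Real.log p - Real.log (Z ω)) ∂P := by
    rw [integral_sub (integrable_const _) hint]
    simp
  rw [h1, ← lintegral_const_mul _ (by fun_prop), ← lintegral_indicator hS,
    ← lintegral_add_left (by fun_prop)]
  calc ENNReal.ofReal (∫ ω, (Real.log p - Real.log (Z ω)) ∂P)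
      ≤ ENNReal.ofReal (∫ ω, max (Real.log p - Real.log (Z ω)) 0 ∂P) :=
        ENNReal.ofReal_le_ofReal (integral_mono hint' hint'.pos_part fun ω => le_max_left _ _)
    _ = ∫⁻ ω, ENNReal.ofReal (max (Real.log p - Real.log (Z ω)) 0) ∂P :=
        ofReal_integral_eq_lintegral_ofReal hint'.pos_part (ae_of_all _ fun ω => le_max_right _ _)
    _ ≤ _ := by
        refine lintegral_mono_ae ?_
        filter_upwards [hpos] with ω hω
        have hA : 0 ≤ K + |Real.log p| := by positivity
        have hlogp : Real.log p ≤ |Real.log p| := le_abs_self _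
        rw [← ENNReal.ofReal_mul (by positivity)]
        rcases le_or_gt (p / 2) (Z ω) with hZp | hZp
        · refine le_add_right ?_
          rcases le_or_gt p (Z ω) with hZp' | hZp'
          · rw [max_eq_right (by linarith [Real.log_le_log hp hZp'])]
            simp
          · refine ENNReal.ofReal_le_ofReal (max_le ?_ ?_)
            · have h2 := Real.log_le_sub_one_of_pos (div_pos hp hω)
              rw [Real.log_div hp.ne' hω.ne'] at h2
              have h3 : p / Z ω - 1 ≤ 2 / p * (p - Z ω) := by
                rw [div_sub_one hω.ne', div_mul_eq_mul_div, div_le_div_iff₀ hω hp]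
                nlinarith
              have h4 : 0 ≤ 2 / p * (p - Z ω) := mul_nonneg (by positivity) (by linarith)
              nlinarith
            · exact mul_nonneg (by positivity) (by linarith)
        · have h5 : 1 + K + |Real.log p| ≤ 2 / p * (1 + K + |Real.log p|) * (p - Z ω) := by
            have h6 : 1 ≤ 2 / p * (p - Z ω) := by
              rw [div_mul_eq_mul_div, le_div_iff₀ hp]
              linarith
            nlinarith
          by_cases h7 : (K : ℝ) < -Real.log (Z ω)
          · rw [Set.indicator_of_mem (by exact h7), ← ENNReal.ofReal_add (by linarith)
              (by linarith [K.2])]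
            exact ENNReal.ofReal_le_ofReal (max_le (by linarith [K.2]) (by linarith [K.2]))
          · rw [Set.indicator_of_notMem (by exact h7), add_zero]
            exact ENNReal.ofReal_le_ofReal (max_le (by linarith) (by linarith))

/-- Convergence of expected logarithms, along random variables on varying probability spaces. -/
theorem tendsto_integral_log {Ω : ℕ → Type*} [∀ N, MeasurableSpace (Ω N)]
    {P : ∀ N, Measure (Ω N)} {Z : ∀ N, Ω N → ℝ} (hP : ∀ᶠ N in atTop, IsProbabilityMeasure (P N))
    (hZ : ∀ N, Measurable (Z N)) (hpos : ∀ᶠ N in atTop, ∀ᵐ ω ∂(P N), 0 < Z N ω) {p : ℝ} (hp : 0 < p)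
    (hE : ∀ᶠ N in atTop, ∫⁻ ω, ENNReal.ofReal (Z N ω) ∂(P N) = ENNReal.ofReal p)
    (hdev : Tendsto (fun N => ∫⁻ ω, ENNReal.ofReal (p - Z N ω) ∂(P N)) atTop (𝓝 0))
    (hint : ∀ᶠ N in atTop, Integrable (fun ω => Real.log (Z N ω)) (P N))
    (hUI : ∀ ε : ℝ≥0, 0 < ε → ∃ K : ℝ≥0, ∀ᶠ N in atTop,
      ∫⁻ ω in {ω | (K : ℝ) < -Real.log (Z N ω)}, ENNReal.ofReal (-Real.log (Z N ω)) ∂(P N) ≤ ε) :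
    Tendsto (fun N => ∫ ω, Real.log (Z N ω) ∂(P N)) atTop (𝓝 (Real.log p)) := by
  rw [Metric.tendsto_nhds]
  intro δ hδ
  obtain ⟨K, hK⟩ := hUI (Real.toNNReal (δ / 4)) (by simpa using hδ)
  have hA := ENNReal.Tendsto.const_mul (a := ENNReal.ofReal (2 / p * (1 + K + |Real.log p|))) hdev
    (Or.inr ENNReal.ofReal_ne_top)
  rw [mul_zero, ENNReal.tendsto_nhds_zero] at hA
  filter_upwards [hP, hpos, hE, hint, hK, hA (ENNReal.ofReal (δ / 4)) (by simpa using hδ)] with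
    N h1 h2 h3 h4 h5 h6
  have h7 := integral_log_le_log (hZ N) h2 hp h3 h4
  have h8 := (log_sub_integral_log_le (hZ N) h2 hp h4 K).trans (add_le_add h6 h5)
  change _ ≤ ENNReal.ofReal (δ / 4) + ENNReal.ofReal (δ / 4) at h8
  rw [← ENNReal.ofReal_add (by positivity) (by positivity),
    ENNReal.ofReal_le_ofReal_iff (by positivity)] at h8
  rw [Real.dist_eq, abs_sub_comm, abs_of_nonneg (by linarith)]
  linarith

end LogLimit

/-! ### The law of large numbers -/

section LawOfLargeNumbers

variable (M : StateSpaceModel X Y ν ρ) (r : Proposal X Y ν) (y : ℕ → Y)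

/-- Test functions may be truncated in the law of large numbers: the lower deviation of the estimate
only increases by the mass that truncation removes. -/
theorem tendsto_lintegral_sub_weightedMean_of_bounded [SFinite ν] {t : ℕ}
    (h : ∀ φ : X × ℝ≥0 → ℝ≥0∞, Measurable φ → ∫⁻ p, φ p ∂(weightedLaw M r y t) ≠ ∞ →
      (∃ C : ℝ≥0, ∀ p, φ p ≤ C) → Tendsto (fun N : ℕ => ∫⁻ h,
        (∫⁻ p, φ p ∂(weightedLaw M r y t) - weightedMean φ h) ∂(smcLaw M r y N t)) atTop (𝓝 0))
    {φ : X × ℝ≥0 → ℝ≥0∞} (hφ : Measurable φ) (hfin : ∫⁻ p, φ p ∂(weightedLaw M r y t) ≠ ∞) :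
    Tendsto (fun N : ℕ => ∫⁻ h, (∫⁻ p, φ p ∂(weightedLaw M r y t) - weightedMean φ h)
      ∂(smcLaw M r y N t)) atTop (𝓝 0) := by
  set μ := weightedLaw M r y t with hμ
  set T : ℕ → X × ℝ≥0 → ℝ≥0∞ := fun n p => min (φ p) n with hT
  have hTm : ∀ n, Measurable (T n) := fun n => hφ.min measurable_const
  have hTle : ∀ n p, T n p ≤ φ p := fun n p => min_le_left _ _
  have hTlim : Tendsto (fun n => ∫⁻ p, T n p ∂μ) atTop (𝓝 (∫⁻ p, φ p ∂μ)) := by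
    refine lintegral_tendsto_of_tendsto_of_monotone (fun n => (hTm n).aemeasurable)
      (ae_of_all _ fun p a b hab => min_le_min_left _ (by exact_mod_cast hab))
      (ae_of_all _ fun p => ?_)
    have := tendsto_const_nhds (x := φ p).min ENNReal.tendsto_nat_nhds_top
    simpa using this
  have hsub := ENNReal.Tendsto.sub (tendsto_const_nhds (x := ∫⁻ p, φ p ∂μ)) hTlim (Or.inl hfin)
  rw [tsub_self, ENNReal.tendsto_nhds_zero] at hsub
  rw [ENNReal.tendsto_nhds_zero]
  intro ε hε
  have hε2 : 0 < ε / 2 := ENNReal.half_pos hε.ne'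
  obtain ⟨n, hn⟩ := (hsub (ε / 2) hε2).exists
  have h1 := h (T n) (hTm n) (ne_top_of_le_ne_top hfin (lintegral_mono (hTle n)))
    ⟨n, fun p => (min_le_right (φ p) (n : ℝ≥0∞)).trans_eq (by simp)⟩
  rw [ENNReal.tendsto_nhds_zero] at h1
  filter_upwards [h1 (ε / 2) hε2, eventually_ge_atTop 1] with N hN hN1
  have : NeZero N := ⟨by omega⟩
  calc ∫⁻ h, (∫⁻ p, φ p ∂μ - weightedMean φ h) ∂(smcLaw M r y N t)
      ≤ ∫⁻ h, (ε / 2 + (∫⁻ p, T n p ∂μ - weightedMean (T n) h)) ∂(smcLaw M r y N t) := by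
        refine lintegral_mono fun h => ?_
        have h2 : weightedMean (T n) h ≤ weightedMean φ h :=
          mul_le_mul_right (empiricalMean_mono (hTle n) _) _
        calc ∫⁻ p, φ p ∂μ - weightedMean φ h
            ≤ (∫⁻ p, φ p ∂μ - ∫⁻ p, T n p ∂μ) + (∫⁻ p, T n p ∂μ - weightedMean φ h) :=
              tsub_le_tsub_add_tsub
          _ ≤ _ := add_le_add hn (tsub_le_tsub_left h2 _)
    _ = ε / 2 + ∫⁻ h, (∫⁻ p, T n p ∂μ - weightedMean (T n) h) ∂(smcLaw M r y N t) := by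
        rw [lintegral_add_left measurable_const]
        simp
    _ ≤ ε / 2 + ε / 2 := by gcongr
    _ = ε := ENNReal.add_halves ε

theorem tendsto_ofReal_const_div_sqrt (c : ℝ) :
    Tendsto (fun N : ℕ => ENNReal.ofReal (c / √N)) atTop (𝓝 0) := by
  have h : Tendsto (fun N : ℕ => c / √(N : ℝ)) atTop (𝓝 0) :=
    Tendsto.const_div_atTop (Real.tendsto_sqrt_atTop.comp tendsto_natCast_atTop_atTop) c
  simpa using ENNReal.tendsto_ofReal h

/-- The weak law of large numbers for sequential Monte Carlo. Only the lower deviation is needed;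
since the estimates are unbiased, it controls the whole `L¹` distance. -/
theorem tendsto_lintegral_sub_weightedMean [SFinite ν] {t : ℕ}
    (hw : ∀ s < t, ∫⁻ p, p.2 ∂(weightedLaw M r y s) ≠ ∞)
    {φ : X × ℝ≥0 → ℝ≥0∞} (hφ : Measurable φ) (hfin : ∫⁻ p, φ p ∂(weightedLaw M r y t) ≠ ∞) :
    Tendsto (fun N : ℕ => ∫⁻ h, (∫⁻ p, φ p ∂(weightedLaw M r y t) - weightedMean φ h)
      ∂(smcLaw M r y N t)) atTop (𝓝 0) := by
  induction t generalizing φ with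
  | zero =>
    refine tendsto_lintegral_sub_weightedMean_of_bounded M r y (fun φ hφ hfin ⟨C, hC⟩ => ?_) hφ hfin
    refine tendsto_of_tendsto_of_tendsto_of_le_of_le' tendsto_const_nhds
      (tendsto_ofReal_const_div_sqrt (1 + C ^ 2)) (Eventually.of_forall fun _ => zero_le) ?_
    filter_upwards [eventually_ge_atTop 1] with N hN1
    have : NeZero N := ⟨by omega⟩
    rw [lintegral_smcLaw_zero M r y N ((measurable_weightedMean hφ).const_sub _)]
    simpa [weightedMean, pastWeight, weightedLaw] using
      lintegral_sub_empiricalMean_le (initParticleLaw M r) hφ hC N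
  | succ t ih =>
    refine tendsto_lintegral_sub_weightedMean_of_bounded M r y (fun φ hφ hfin ⟨C, hC⟩ => ?_) hφ hfin
    set φ' : X × ℝ≥0 → ℝ≥0∞ :=
      fun p => p.2 * ∫⁻ q, φ q ∂(particleKernel M r y (t + 1) p.1) with hφ'
    have hφ'm : Measurable φ' := measurable_weight_mul_lintegral M r y (t + 1) hφ
    have heq : ∫⁻ p, φ p ∂(weightedLaw M r y (t + 1)) = ∫⁻ p, φ' p ∂(weightedLaw M r y t) :=
      lintegral_weightedLaw_succ M r y t hφ
    have ih' := ih (fun s hs => hw s (by omega)) hφ'm (heq ▸ hfin)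
    have hlim := ih'.add (ENNReal.Tendsto.const_mul (a := ∫⁻ p, p.2 ∂(weightedLaw M r y t))
      (tendsto_ofReal_const_div_sqrt (1 + C ^ 2)) (Or.inr (hw t t.lt_succ_self)))
    rw [mul_zero, add_zero] at hlim
    refine tendsto_of_tendsto_of_tendsto_of_le_of_le' tendsto_const_nhds hlim
      (Eventually.of_forall fun _ => zero_le) ?_
    filter_upwards [eventually_ge_atTop 1] with N hN1
    have : NeZero N := ⟨by omega⟩
    have hwm := measurable_weightedMean (N := N) (t := t) hφ'm
    have hem := measurable_empiricalMean (N := N) hφ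
    rw [lintegral_smcLaw_succ M r y N (t := t)
      ((measurable_weightedMean hφ).const_sub _), heq,
      ← lintegral_weightedMean M r y N t (φ := fun p => (p.2 : ℝ≥0∞)) (by fun_prop),
      ← lintegral_mul_const _ (measurable_weightedMean (by fun_prop)),
      ← lintegral_add_left (by fun_prop)]
    refine lintegral_mono fun h => ?_
    set m := stepParticleLaw M r y (t + 1) (h (Fin.last t))
    set W : ℝ≥0 := pastWeight h * meanWeight (h (Fin.last t)) with hW
    have hWφ' : weightedMean φ' h = W * ∫⁻ p, φ p ∂m :=
      (pastWeight_mul_lintegral_stepParticleLaw M r y h φ (t + 1)).symm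
    have hWw : weightedMean (fun p => (p.2 : ℝ≥0∞)) h = W := by
      rw [weightedMean, ← coe_meanWeight, hW, ENNReal.coe_mul]
    calc ∫⁻ g, (∫⁻ p, φ' p ∂(weightedLaw M r y t) -
          weightedMean φ (Fin.snoc (α := fun _ => Generation X N) h g : Fin (t + 2) → _))
          ∂(Measure.pi fun _ : Fin N => m)
        ≤ ∫⁻ g, ((∫⁻ p, φ' p ∂(weightedLaw M r y t) - weightedMean φ' h) +
            W * (∫⁻ p, φ p ∂m - empiricalMean φ g)) ∂(Measure.pi fun _ : Fin N => m) := by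
          refine lintegral_mono fun g => ?_
          rw [ENNReal.mul_sub fun _ _ => ENNReal.coe_ne_top, ← hWφ']
          simp only [weightedMean, pastWeight_snoc, Fin.snoc_last]
          exact tsub_le_tsub_add_tsub
      _ ≤ (∫⁻ p, φ' p ∂(weightedLaw M r y t) - weightedMean φ' h) +
            W * ENNReal.ofReal ((1 + C ^ 2) / √N) := by
          rw [lintegral_add_left measurable_const, lintegral_const_mul _ (by fun_prop)]
          simp only [lintegral_const, measure_univ, mul_one]
          gcongr
          exact lintegral_sub_empiricalMean_le m hφ hC N
      _ = _ := by rw [hWw]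

end LawOfLargeNumbers

/-! ### Domination by the proposal -/

section Domination

variable (M : StateSpaceModel X Y ν ρ) (r : Proposal X Y ν) (y : ℕ → Y)

/-- The law of a weighted particle at time `s` that is moved by the proposal without resampling. -/
noncomputable def proposalLaw : ℕ → Measure (X × ℝ≥0)
  | 0 => initParticleLaw M r
  | s + 1 => (proposalLaw s).bind fun p => particleKernel M r y (s + 1) p.1

theorem lintegral_proposalLaw_succ [SFinite ν] (s : ℕ) {φ : X × ℝ≥0 → ℝ≥0∞} (hφ : Measurable φ) :
    ∫⁻ p, φ p ∂(proposalLaw M r y (s + 1)) =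
      ∫⁻ p, ∫⁻ q, φ q ∂(particleKernel M r y (s + 1) p.1) ∂(proposalLaw M r y s) := by
  have h : Measurable fun p : X × ℝ≥0 => particleKernel M r y (s + 1) p.1 :=
    (measurable_particleKernel M r y (s + 1)).comp measurable_fst
  rw [proposalLaw, Measure.lintegral_bind h.aemeasurable hφ.aemeasurable]

theorem measurable_lintegral_particleKernel_fst [SFinite ν] (s : ℕ) {φ : X × ℝ≥0 → ℝ≥0∞}
    (hφ : Measurable φ) :
    Measurable fun p : X × ℝ≥0 => ∫⁻ q, φ q ∂(particleKernel M r y s p.1) :=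
  (measurable_lintegral_particleKernel M r y s hφ).comp measurable_fst

theorem lintegral_stepParticleLaw_le {N : ℕ} [NeZero N] (s : ℕ) (g : Generation X N)
    (φ : X × ℝ≥0 → ℝ≥0∞) :
    ∫⁻ p, φ p ∂(stepParticleLaw M r y s g) ≤
      N * empiricalMean (fun p => ∫⁻ q, φ q ∂(particleKernel M r y s p.1)) g := by
  rw [lintegral_stepParticleLaw, empiricalMean,
    ENNReal.mul_div_cancel (by exact_mod_cast NeZero.ne N) (by simp)]
  refine Finset.sum_le_sum fun j _ => mul_le_of_le_one_left' ?_
  exact_mod_cast ancestorProb_le_one g j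

/-- Without resampling, that is, for a single particle, the particles follow the proposal. -/
theorem lintegral_empiricalMean_smcLaw_one [SFinite ν] (t : ℕ) {φ : X × ℝ≥0 → ℝ≥0∞}
    (hφ : Measurable φ) :
    ∫⁻ h, empiricalMean φ (h (Fin.last t)) ∂(smcLaw M r y 1 t) =
      ∫⁻ p, φ p ∂(proposalLaw M r y t) := by
  induction t generalizing φ with
  | zero => rw [lintegral_empiricalMean_smcLaw_zero M r y 1 hφ, proposalLaw]
  | succ t ih =>
    rw [lintegral_empiricalMean_smcLaw_succ M r y 1 t hφ, lintegral_proposalLaw_succ M r y t hφ,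
      ← ih (measurable_lintegral_particleKernel_fst M r y (t + 1) hφ)]
    refine lintegral_congr fun h => ?_
    have h1 : ancestorProb (h (Fin.last t)) 0 = 1 := by
      simpa using sum_ancestorProb (h (Fin.last t))
    simp [lintegral_stepParticleLaw, empiricalMean, h1]

/-- A crude comparison with the proposal: every resampling step costs at most a factor `N`. -/
theorem lintegral_empiricalMean_le_pow [SFinite ν] (N : ℕ) [NeZero N] (t : ℕ)
    {φ : X × ℝ≥0 → ℝ≥0∞} (hφ : Measurable φ) :
    ∫⁻ h, empiricalMean φ (h (Fin.last t)) ∂(smcLaw M r y N t) ≤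
      N ^ t * ∫⁻ p, φ p ∂(proposalLaw M r y t) := by
  induction t generalizing φ with
  | zero =>
    rw [lintegral_empiricalMean_smcLaw_zero M r y N hφ]
    simp [proposalLaw]
  | succ t ih =>
    have hK := measurable_lintegral_particleKernel_fst M r y (t + 1) hφ
    have hm := measurable_empiricalMean hK (N := N)
    rw [lintegral_empiricalMean_smcLaw_succ M r y N t hφ, lintegral_proposalLaw_succ M r y t hφ]
    refine (lintegral_mono fun h => lintegral_stepParticleLaw_le M r y (t + 1) _ φ).trans ?_
    rw [lintegral_const_mul _ (by fun_prop), pow_succ', mul_assoc]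
    gcongr
    exact ih hK

/-- The weight of a particle relative to a bound `C`, cut off at `1`. -/
noncomputable def relativeWeight (C : ℝ≥0) (p : X × ℝ≥0) : ℝ≥0 := min (p.2 / C) 1

theorem measurable_relativeWeight (C : ℝ≥0) : Measurable (relativeWeight (X := X) C) :=
  (measurable_snd.div_const C).min measurable_const

omit [MeasurableSpace X] in
theorem relativeWeight_le_one (C : ℝ≥0) (p : X × ℝ≥0) : relativeWeight C p ≤ 1 := min_le_right _ _

omit [MeasurableSpace X] in
theorem mul_relativeWeight_le {C : ℝ≥0} (hC : 0 < C) (p : X × ℝ≥0) :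
    C * relativeWeight C p ≤ p.2 :=
  (mul_le_mul_right (min_le_left _ _) C).trans_eq (mul_div_cancel₀ _ hC.ne')

theorem lintegral_relativeWeight_mul_ne_zero {C : ℝ≥0} (hC : 0 < C) {μ : Measure (X × ℝ≥0)}
    {f : X × ℝ≥0 → ℝ≥0∞} (hf : Measurable f) (h : ∫⁻ p, p.2 * f p ∂μ ≠ 0) :
    ∫⁻ p, relativeWeight C p * f p ∂μ ≠ 0 := by
  have hm := measurable_relativeWeight (X := X) C
  contrapose! h
  rw [lintegral_eq_zero_iff (by fun_prop)] at h ⊢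
  filter_upwards [h] with p hp
  rcases mul_eq_zero.1 hp with h1 | h1
  · have h2 : p.2 = 0 := by
      by_contra h3
      have : 0 < relativeWeight C p := lt_min (div_pos (pos_iff_ne_zero.2 h3) hC) one_pos
      exact this.ne' (by exact_mod_cast h1)
    simp [h2]
  · simp [h1]

omit [MeasurableSpace X] in
theorem meanWeight_le {N : ℕ} [NeZero N] {C : ℝ≥0} {g : Generation X N} (hg : ∀ i, (g i).2 ≤ C) :
    meanWeight g ≤ C := by
  rw [meanWeight, div_le_iff₀ (by exact_mod_cast Nat.pos_of_ne_zero (NeZero.ne N)), mul_comm]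
  simpa using Finset.sum_le_card_nsmul Finset.univ (fun i => (g i).2) C fun i _ => hg i

omit [MeasurableSpace X] in
theorem mul_empiricalMean (c : ℝ≥0∞) (φ : X × ℝ≥0 → ℝ≥0∞) {N : ℕ} (g : Generation X N) :
    c * empiricalMean φ g = empiricalMean (fun p => c * φ p) g := by
  rw [empiricalMean, empiricalMean, ← Finset.mul_sum, mul_div_assoc]

/-- For bounded weights, the mean of `φ` under resampling is at least an empirical mean. -/
theorem empiricalMean_relativeWeight_le {N : ℕ} [NeZero N] {C : ℝ≥0} (hC : 0 < C) (s : ℕ)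
    {g : Generation X N} (hg : ∀ i, (g i).2 ≤ C) (φ : X × ℝ≥0 → ℝ≥0∞) :
    empiricalMean (fun p => relativeWeight C p * ∫⁻ q, φ q ∂(particleKernel M r y s p.1)) g ≤
      ∫⁻ p, φ p ∂(stepParticleLaw M r y s g) := by
  have hC0 : (C : ℝ≥0∞) ≠ 0 := by exact_mod_cast hC.ne'
  rw [← ENNReal.mul_le_mul_iff_right hC0 ENNReal.coe_ne_top, mul_empiricalMean]
  calc _ ≤ empiricalMean (fun p => p.2 * ∫⁻ q, φ q ∂(particleKernel M r y s p.1)) g := by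
        refine empiricalMean_mono (fun p => ?_) g
        rw [← mul_assoc]
        gcongr
        exact_mod_cast mul_relativeWeight_le hC p
    _ = meanWeight g * ∫⁻ p, φ p ∂(stepParticleLaw M r y s g) :=
        (meanWeight_mul_lintegral_stepParticleLaw M r y s g φ).symm
    _ ≤ _ := by
        gcongr
        exact meanWeight_le hg

/-- If the weights are bounded and not all small, resampling costs only a constant factor. -/
theorem mul_lintegral_stepParticleLaw_le {N : ℕ} [NeZero N] {C : ℝ≥0} (hC : 0 < C) (s : ℕ)
    {g : Generation X N} (hg : ∀ i, (g i).2 ≤ C) (φ : X × ℝ≥0 → ℝ≥0∞) :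
    empiricalMean (fun p => (relativeWeight C p : ℝ≥0∞)) g *
        ∫⁻ p, φ p ∂(stepParticleLaw M r y s g) ≤
      empiricalMean (fun p => ∫⁻ q, φ q ∂(particleKernel M r y s p.1)) g := by
  have hC0 : (C : ℝ≥0∞) ≠ 0 := by exact_mod_cast hC.ne'
  rw [← ENNReal.mul_le_mul_iff_right hC0 ENNReal.coe_ne_top, ← mul_assoc, mul_empiricalMean]
  calc _ ≤ meanWeight g * ∫⁻ p, φ p ∂(stepParticleLaw M r y s g) := by
        gcongr
        rw [coe_meanWeight]
        exact empiricalMean_mono (fun p => by exact_mod_cast mul_relativeWeight_le hC p) g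
    _ = empiricalMean (fun p => p.2 * ∫⁻ q, φ q ∂(particleKernel M r y s p.1)) g :=
        meanWeight_mul_lintegral_stepParticleLaw M r y s g φ
    _ ≤ _ := by
        rw [mul_empiricalMean]
        refine ENNReal.div_le_div_right (Finset.sum_le_sum fun i _ => ?_) _
        exact mul_le_mul_left (by exact_mod_cast hg i) _

theorem tendsto_pow_mul_exp_neg (k : ℕ) {b : ℝ} (hb : 0 < b) :
    Tendsto (fun N : ℕ => (N : ℝ≥0∞) ^ k * ENNReal.ofReal (2 * Real.exp (-b * N))) atTop (𝓝 0) := by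
  have h := (tendsto_pow_const_mul_const_pow_of_abs_lt_one k (r := Real.exp (-b)) (by
    rw [abs_of_pos (Real.exp_pos _), Real.exp_lt_one_iff]; linarith)).const_mul 2
  have h' := ENNReal.tendsto_ofReal h
  rw [mul_zero, ENNReal.ofReal_zero] at h'
  refine h'.congr fun N => ?_
  rw [← ENNReal.ofReal_natCast, ← ENNReal.ofReal_pow (by positivity),
    ← ENNReal.ofReal_mul (by positivity), ← Real.exp_nat_mul]
  ring_nf

/-- The generations degenerate with a probability that decays faster than every power of `N`: the
empirical mean of a bounded test function `φ`, not negligible for `weightedLaw`, stays above some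
`c > 0`. The exceptional event is measured against arbitrary unbounded `g`, uniformly in `g`, since
the induction over time needs this: the crude bound then loses a factor `N` on that event only. -/
theorem exists_lintegral_indicator_le [SFinite ν] {C : ℝ≥0} (hC : 0 < C) {t : ℕ}
    (hbd : ∀ N : ℕ, N ≠ 0 → ∀ s < t, ∀ᵐ h ∂(smcLaw M r y N s), ∀ i, (h (Fin.last s) i).2 ≤ C)
    {φ : X × ℝ≥0 → ℝ≥0∞} (hφ : Measurable φ) (hφ1 : ∀ p, φ p ≤ 1)
    (hφ0 : ∫⁻ p, φ p ∂(weightedLaw M r y t) ≠ 0) :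
    ∃ c : ℝ, 0 < c ∧ c ≤ 1 ∧ ∃ ε : ℕ → ℝ≥0∞,
      (∀ k : ℕ, Tendsto (fun N : ℕ => (N : ℝ≥0∞) ^ k * ε N) atTop (𝓝 0)) ∧
      ∀ N : ℕ, N ≠ 0 → ∀ g : X × ℝ≥0 → ℝ≥0∞, Measurable g →
        ∫⁻ h, {h : Fin (t + 1) → Generation X N |
            empiricalMean φ (h (Fin.last t)) < ENNReal.ofReal c}.indicator
          (fun h => empiricalMean g (h (Fin.last t))) h ∂(smcLaw M r y N t) ≤
        ε N * ∫⁻ p, g p ∂(proposalLaw M r y t) := by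
  have hmeas : ∀ (N s : ℕ) (c : ℝ) (φ g : X × ℝ≥0 → ℝ≥0∞), Measurable φ → Measurable g →
      Measurable ({h : Fin (s + 1) → Generation X N |
            empiricalMean φ (h (Fin.last s)) < ENNReal.ofReal c}.indicator
          (fun h => empiricalMean g (h (Fin.last s)))) := by
    intro N s c φ g hφ hg
    exact ((measurable_empiricalMean hg).comp (measurable_pi_apply _)).indicator
      (measurableSet_lt ((measurable_empiricalMean hφ).comp (measurable_pi_apply _))
        measurable_const)
  induction t generalizing φ with
  | zero =>
    have hle : ∫⁻ p, φ p ∂(initParticleLaw M r) ≤ 1 :=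
      (lintegral_mono hφ1).trans_eq (by simp)
    have hne : ∫⁻ p, φ p ∂(initParticleLaw M r) ≠ ∞ := ne_top_of_le_ne_top ENNReal.one_ne_top hle
    set a := (∫⁻ p, φ p ∂(initParticleLaw M r)).toReal with ha
    have ha0 : 0 < a := ENNReal.toReal_pos hφ0 hne
    have ha1 : a ≤ 1 := by simpa using ENNReal.toReal_mono ENNReal.one_ne_top hle
    refine ⟨a / 4, by positivity, by linarith,
      fun N => ENNReal.ofReal (2 * Real.exp (-(a / 4) * N)),
      fun k => tendsto_pow_mul_exp_neg k (by positivity), fun N hN g hg => ?_⟩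
    have : NeZero N := ⟨hN⟩
    rw [lintegral_smcLaw_zero M r y N (hmeas N 0 _ φ g hφ hg)]
    exact lintegral_empiricalMean_indicator_le (initParticleLaw M r) hφ hg hφ1 ha1
      (ENNReal.ofReal_toReal hne).le N
  | succ t ih =>
    set ψ : X × ℝ≥0 → ℝ≥0∞ :=
      fun p => relativeWeight C p * ∫⁻ q, φ q ∂(particleKernel M r y (t + 1) p.1) with hψ
    have hKφ := measurable_lintegral_particleKernel_fst M r y (t + 1) hφ
    have hψm : Measurable ψ := (measurable_relativeWeight C).coe_nnreal_ennreal.mul hKφ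
    have hψ1 : ∀ p, ψ p ≤ 1 := fun p => by
      refine mul_le_one' (by exact_mod_cast relativeWeight_le_one C p) ?_
      exact (lintegral_mono hφ1).trans_eq (by simp)
    have hψ0 : ∫⁻ p, ψ p ∂(weightedLaw M r y t) ≠ 0 := by
      rw [lintegral_weightedLaw_succ M r y t hφ] at hφ0
      exact lintegral_relativeWeight_mul_ne_zero hC hKφ hφ0
    obtain ⟨c, hc0, hc1, ε, hε, hN⟩ := ih (fun N hN s hs => hbd N hN s (by omega)) hψm hψ1 hψ0
    -- Off the exceptional event of time `t` the Chernoff bound applies, and on it the crude bound;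
    -- both lose powers of `N`, which the two exceptional probabilities absorb.
    refine ⟨c / 4, by positivity, by linarith,
      fun N => ENNReal.ofReal (2 * Real.exp (-(c / 4) * N)) * N ^ (t + 1) + N * ε N,
      fun k => ?_, fun N hN0 g hg => ?_⟩
    · have h1 := (tendsto_pow_mul_exp_neg (k + (t + 1)) (b := c / 4) (by positivity)).add
        (hε (k + 1))
      rw [add_zero] at h1
      refine h1.congr fun N => ?_
      rw [pow_add, pow_succ, mul_add]
      ring
    · have : NeZero N := ⟨hN0⟩
      set e := ENNReal.ofReal (2 * Real.exp (-(c / 4) * N)) with he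
      set m : (Fin (t + 1) → Generation X N) → Measure (X × ℝ≥0) :=
        fun h => stepParticleLaw M r y (t + 1) (h (Fin.last t)) with hm
      set Kg : X × ℝ≥0 → ℝ≥0∞ := fun p => ∫⁻ q, g q ∂(particleKernel M r y (t + 1) p.1) with hKg
      have hKgm : Measurable Kg := measurable_lintegral_particleKernel_fst M r y (t + 1) hg
      have hmg : Measurable fun h => ∫⁻ p, g p ∂(m h) :=
        (measurable_lintegral_stepParticleLaw M r y (t + 1) hg).comp (measurable_pi_apply _)
      have hemg := measurable_empiricalMean hg (N := N)
      set B := {h : Fin (t + 1) → Generation X N |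
        empiricalMean ψ (h (Fin.last t)) < ENNReal.ofReal c} with hB
      rw [lintegral_smcLaw_succ M r y N t (hmeas N (t + 1) _ φ g hφ hg)]
      calc _ ≤ ∫⁻ h, (e * ∫⁻ p, g p ∂(m h) +
              N * B.indicator (fun h => empiricalMean Kg (h (Fin.last t))) h)
              ∂(smcLaw M r y N t) := by
            refine lintegral_mono_ae ?_
            filter_upwards [hbd N hN0 t t.lt_succ_self] with h hh
            have hind : ∀ g' : Generation X N, {h : Fin (t + 1 + 1) → Generation X N |
                empiricalMean φ (h (Fin.last (t + 1))) < ENNReal.ofReal (c / 4)}.indicator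
                (fun h => empiricalMean g (h (Fin.last (t + 1))))
                  (Fin.snoc (α := fun _ => Generation X N) h g') =
                {g' : Generation X N | empiricalMean φ g' < ENNReal.ofReal (c / 4)}.indicator
                  (empiricalMean g) g' := fun g' => by
              simp [Set.indicator_apply]
            simp only [hind]
            by_cases hhB : h ∈ B
            · refine le_add_left ?_
              rw [Set.indicator_of_mem hhB]
              refine (lintegral_mono fun g' => Set.indicator_le_self _ _ _).trans ?_
              rw [lintegral_empiricalMean _ hg]
              exact lintegral_stepParticleLaw_le M r y (t + 1) _ g
            · refine le_add_right ?_
              exact lintegral_empiricalMean_indicator_le (m h) hφ hg hφ1 hc1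
                ((not_lt.1 hhB).trans (empiricalMean_relativeWeight_le M r y hC (t + 1) hh φ)) N
        _ = e * ∫⁻ h, ∫⁻ p, g p ∂(m h) ∂(smcLaw M r y N t) +
              N * ∫⁻ h, B.indicator (fun h => empiricalMean Kg (h (Fin.last t))) h
                ∂(smcLaw M r y N t) := by
            rw [lintegral_add_left (by fun_prop), lintegral_const_mul _ hmg,
              lintegral_const_mul _ (hmeas N t c ψ Kg hψm hKgm)]
        _ ≤ e * (N ^ (t + 1) * ∫⁻ p, g p ∂(proposalLaw M r y (t + 1))) +
              N * (ε N * ∫⁻ p, g p ∂(proposalLaw M r y (t + 1))) := by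
            gcongr
            · rw [← lintegral_empiricalMean_smcLaw_succ M r y N t hg]
              exact lintegral_empiricalMean_le_pow M r y N (t + 1) hg
            · rw [lintegral_proposalLaw_succ M r y t hg]
              exact hN N hN0 Kg hKgm
        _ = _ := by ring

/-- For bounded weights and many particles, the particles of a run are dominated by the proposal, up
to a factor that does not depend on the number of particles. -/
theorem exists_lintegral_empiricalMean_le [SFinite ν] {C : ℝ≥0} (hC : 0 < C) {t : ℕ}
    (hbd : ∀ N : ℕ, N ≠ 0 → ∀ s < t, ∀ᵐ h ∂(smcLaw M r y N s), ∀ i, (h (Fin.last s) i).2 ≤ C)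
    (hw : ∀ s < t, ∫⁻ p, p.2 ∂(weightedLaw M r y s) ≠ 0) :
    ∃ A : ℝ≥0, ∀ᶠ N : ℕ in atTop, ∀ g : X × ℝ≥0 → ℝ≥0∞, Measurable g →
      ∫⁻ h, empiricalMean g (h (Fin.last t)) ∂(smcLaw M r y N t) ≤
        A * ∫⁻ p, g p ∂(proposalLaw M r y t) := by
  induction t with
  | zero =>
    refine ⟨1, ?_⟩
    filter_upwards [eventually_ge_atTop 1] with N hN g hg
    have : NeZero N := ⟨by omega⟩
    rw [lintegral_empiricalMean_smcLaw_zero M r y N hg]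
    simp [proposalLaw]
  | succ t ih =>
    obtain ⟨A, hA⟩ := ih (fun N hN s hs => hbd N hN s (by omega)) (fun s hs => hw s (by omega))
    have hφ : Measurable fun p : X × ℝ≥0 => (relativeWeight C p : ℝ≥0∞) :=
      (measurable_relativeWeight C).coe_nnreal_ennreal
    obtain ⟨c, hc0, -, ε, hε, hN⟩ := exists_lintegral_indicator_le M r y hC (t := t)
      (fun N hN s hs => hbd N hN s (by omega)) hφ
      (fun p => by exact_mod_cast relativeWeight_le_one C p) (by
        simpa using lintegral_relativeWeight_mul_ne_zero hC (f := fun _ => 1) measurable_const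
          (by simpa using hw t t.lt_succ_self))
    have hε1 := hε 1
    rw [ENNReal.tendsto_nhds_zero] at hε1
    refine ⟨(Real.toNNReal c)⁻¹ * A + 1, ?_⟩
    filter_upwards [hA, hε1 1 one_pos, eventually_ge_atTop 1] with N hAN hεN hN1 g hg
    have : NeZero N := ⟨by omega⟩
    set Kg : X × ℝ≥0 → ℝ≥0∞ := fun p => ∫⁻ q, g q ∂(particleKernel M r y (t + 1) p.1) with hKg
    have hKgm : Measurable Kg := measurable_lintegral_particleKernel_fst M r y (t + 1) hg
    have hem := measurable_empiricalMean hKgm (N := N)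
    set B := {h : Fin (t + 1) → Generation X N |
      empiricalMean (fun p => (relativeWeight C p : ℝ≥0∞)) (h (Fin.last t)) < ENNReal.ofReal c}
      with hB
    have hBm : MeasurableSet B :=
      measurableSet_lt ((measurable_empiricalMean hφ).comp (measurable_pi_apply _)) measurable_const
    have hc : ENNReal.ofReal c ≠ 0 := by simpa using hc0
    rw [lintegral_empiricalMean_smcLaw_succ M r y N t hg, lintegral_proposalLaw_succ M r y t hg]
    calc _ ≤ ∫⁻ h, ((ENNReal.ofReal c)⁻¹ * empiricalMean Kg (h (Fin.last t)) +
            N * B.indicator (fun h => empiricalMean Kg (h (Fin.last t))) h)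
            ∂(smcLaw M r y N t) := by
          refine lintegral_mono_ae ?_
          filter_upwards [hbd N (by omega) t t.lt_succ_self] with h hh
          by_cases hhB : h ∈ B
          · refine le_add_left ?_
            rw [Set.indicator_of_mem hhB]
            exact lintegral_stepParticleLaw_le M r y (t + 1) _ g
          · refine le_add_right ?_
            rw [mul_comm, ← div_eq_mul_inv,
              ENNReal.le_div_iff_mul_le (Or.inl hc) (Or.inl ENNReal.ofReal_ne_top), mul_comm]
            exact (mul_le_mul_left (not_lt.1 hhB) _).trans
              (mul_lintegral_stepParticleLaw_le M r y hC (t + 1) hh g)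
      _ = (ENNReal.ofReal c)⁻¹ * ∫⁻ h, empiricalMean Kg (h (Fin.last t)) ∂(smcLaw M r y N t) +
            N * ∫⁻ h, B.indicator (fun h => empiricalMean Kg (h (Fin.last t))) h
              ∂(smcLaw M r y N t) := by
          have h1 : Measurable fun h : Fin (t + 1) → Generation X N =>
            empiricalMean Kg (h (Fin.last t)) := hem.comp (measurable_pi_apply _)
          rw [lintegral_add_left (h1.const_mul _), lintegral_const_mul _ h1,
            lintegral_const_mul _ (h1.indicator hBm)]
      _ ≤ (ENNReal.ofReal c)⁻¹ * (A * ∫⁻ p, Kg p ∂(proposalLaw M r y t)) +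
            N * (ε N * ∫⁻ p, Kg p ∂(proposalLaw M r y t)) := by
          gcongr
          · exact hAN Kg hKgm
          · exact hN N (by omega) Kg hKgm
      _ ≤ (ENNReal.ofReal c)⁻¹ * (A * ∫⁻ p, Kg p ∂(proposalLaw M r y t)) +
            1 * ∫⁻ p, Kg p ∂(proposalLaw M r y t) := by
          rw [← mul_assoc (N : ℝ≥0∞)]
          gcongr
          simpa using hεN
      _ = _ := by
          rw [← mul_assoc, ← add_mul, ENNReal.coe_add, ENNReal.coe_mul, ENNReal.coe_inv (by simpa),
            ENNReal.coe_one]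
          rfl

end Domination

/-! ### Logarithmic losses -/

section LogLoss

/-- The logarithmic loss `log (C / w) ≥ 0` of a particle of weight `w ≤ C`. -/
noncomputable def logLoss (C : ℝ≥0) (p : X × ℝ≥0) : ℝ≥0∞ :=
  ENNReal.ofReal (Real.log C - Real.log p.2)

theorem measurable_logLoss (C : ℝ≥0) : Measurable (logLoss (X := X) C) :=
  (measurable_const.sub (Real.measurable_log.comp measurable_snd.coe_nnreal_real)).ennreal_ofReal

variable {N : ℕ} [NeZero N] {C : ℝ≥0} {g : Generation X N}

omit [MeasurableSpace X] in
/-- Concavity of the logarithm bounds the loss of the mean weight by the mean loss. -/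
theorem ofReal_neg_log_meanWeight_le (hC : 1 ≤ C) (hg0 : ∀ i, 0 < (g i).2)
    (hgC : ∀ i, (g i).2 ≤ C) :
    ENNReal.ofReal (-Real.log (meanWeight g)) ≤ empiricalMean (logLoss C) g := by
  have hN : (0 : ℝ) < N := by exact_mod_cast Nat.pos_of_ne_zero (NeZero.ne N)
  have hlogC : 0 ≤ Real.log C := Real.log_nonneg (by exact_mod_cast hC)
  have hconc := strictConcaveOn_log_Ioi.concaveOn.le_map_sum (t := Finset.univ)
    (w := fun _ : Fin N => (1 : ℝ) / N) (p := fun i => ((g i).2 : ℝ))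
    (fun _ _ => by positivity) (by simp [hN.ne']) (fun i _ => by simpa using hg0 i)
  have hmean : ∑ i : Fin N, (1 / (N : ℝ)) • ((g i).2 : ℝ) = meanWeight g := by
    rw [meanWeight, ← Finset.smul_sum]
    push_cast
    rw [smul_eq_mul]
    ring
  rw [hmean] at hconc
  have hterm : ∀ i, 0 ≤ Real.log C - Real.log (g i).2 := fun i =>
    sub_nonneg.2 (Real.log_le_log (by exact_mod_cast hg0 i) (by exact_mod_cast hgC i))
  have hR : empiricalMean (logLoss C) g =
      ENNReal.ofReal ((∑ i, (Real.log C - Real.log (g i).2)) / N) := by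
    rw [empiricalMean, ENNReal.ofReal_div_of_pos hN, ENNReal.ofReal_natCast,
      ENNReal.ofReal_sum_of_nonneg fun i _ => hterm i]
    rfl
  rw [hR]
  refine ENNReal.ofReal_le_ofReal ?_
  have hsum : (∑ i, (Real.log C - Real.log (g i).2)) / N =
      Real.log C - ∑ i : Fin N, (1 / (N : ℝ)) • Real.log (g i).2 := by
    rw [Finset.sum_sub_distrib, ← Finset.smul_sum]
    simp only [Finset.sum_const, Finset.card_univ, Fintype.card_fin, nsmul_eq_mul, smul_eq_mul]
    field_simp
  rw [hsum]
  linarith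

omit [MeasurableSpace X] in
theorem enorm_log_meanWeight_le (hC : 1 ≤ C) (hg0 : ∀ i, 0 < (g i).2) (hgC : ∀ i, (g i).2 ≤ C) :
    ‖Real.log (meanWeight g)‖ₑ ≤ ENNReal.ofReal (Real.log C) + empiricalMean (logLoss C) g := by
  rw [Real.enorm_eq_ofReal_abs]
  rcases le_or_gt 0 (Real.log (meanWeight g)) with h | h
  · rw [abs_of_nonneg h]
    exact le_add_right (ENNReal.ofReal_le_ofReal (Real.log_le_log
      (by exact_mod_cast meanWeight_pos hg0) (by exact_mod_cast meanWeight_le hgC)))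
  · rw [abs_of_neg h]
    exact le_add_left (ofReal_neg_log_meanWeight_le hC hg0 hgC)

end LogLoss

/-! ### Bounded weights -/

section Bounded

variable (M : StateSpaceModel X Y ν ρ) (r : Proposal X Y ν) (y : ℕ → Y)

omit [MeasurableSpace X] in
theorem log_marginalEstimate {N t : ℕ} {h : Fin (t + 1) → Generation X N}
    (hh : ∀ j, 0 < meanWeight (h j)) :
    Real.log (marginalEstimate h) = ∑ j, Real.log (meanWeight (h j)) :=
  Real.log_prod fun j _ => by exact_mod_cast (hh j).ne'

theorem ae_weight_le [SFinite ν] {C : ℝ≥0} {t : ℕ} (h0 : ∀ x, initWeight M r x ≤ C)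
    (h1 : ∀ s, 1 ≤ s → s ≤ t → ∀ x x', stepWeight M r y s x x' ≤ C) (N : ℕ) [NeZero N] {s : ℕ}
    (hs : s ≤ t) : ∀ᵐ h ∂(smcLaw M r y N s), ∀ j i, (h j i).2 ≤ C := by
  have hS : MeasurableSet {p : X × ℝ≥0 | p.2 ≤ C} :=
    measurableSet_le measurable_snd measurable_const
  refine ae_smcLaw_forall M r y N (S := {p | p.2 ≤ C}) hS ?_ fun j hj0 hjs x => ?_
  · have h2 := measurable_initWeight M r
    change ∀ᵐ p : X × ℝ≥0 ∂_, p.2 ≤ C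
    rw [initParticleLaw, ae_map_iff (by fun_prop) hS]
    exact ae_of_all _ h0
  · have h2 := measurable_stepWeight_right M r y j x
    change ∀ᵐ p : X × ℝ≥0 ∂_, p.2 ≤ C
    rw [particleKernel, ae_map_iff (by fun_prop) hS]
    exact ae_of_all _ (h1 j hj0 (hjs.trans hs) x)

variable {M r y} {C : ℝ≥0} {t : ℕ}

/-- For bounded weights, integrability of the estimate with one particle means that the logarithmic
losses along the proposal are integrable. -/
theorem lintegral_logLoss_proposalLaw_ne_top [SFinite ν] (hsupp : SameSupport M r y t)
    (h0 : ∀ x, initWeight M r x ≤ C)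
    (h1 : ∀ s, 1 ≤ s → s ≤ t → ∀ x x', stepWeight M r y s x x' ≤ C)
    (hint : LogMarginalIntegrable M r y t 1) {s : ℕ} (hs : s ≤ t) :
    ∫⁻ p, logLoss C p ∂(proposalLaw M r y s) ≠ ∞ := by
  have hmean := measurable_empiricalMean (N := 1) (measurable_logLoss (X := X) C)
  have hlt : s < t + 1 := by omega
  rw [← lintegral_empiricalMean_smcLaw_one M r y s (measurable_logLoss C),
    ← lintegral_smcLaw_eval M r y 1 hmean (t := t) ⟨s, hlt⟩]
  have hint' : Integrable (fun h => (t + 1) * Real.log C - Real.log (marginalEstimate h))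
      (smcLaw M r y 1 t) := (integrable_const _).sub hint
  refine ne_top_of_le_ne_top hint'.lintegral_lt_top.ne (lintegral_mono_ae ?_)
  filter_upwards [ae_weight_pos M r y 1 hsupp le_rfl, ae_weight_le M r y h0 h1 1 le_rfl] with
    h hpos hle
  have hm : ∀ j, meanWeight (h j) = (h j 0).2 := fun j => by simp [meanWeight]
  have hterm : ∀ j, 0 ≤ Real.log C - Real.log (h j 0).2 := fun j =>
    sub_nonneg.2 (Real.log_le_log (by exact_mod_cast hpos j 0) (by exact_mod_cast hle j 0))
  rw [log_marginalEstimate fun j => meanWeight_pos (hpos j)]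
  have hsum : (t + 1) * Real.log C - ∑ j, Real.log (meanWeight (h j)) =
      ∑ j, (Real.log C - Real.log (h j 0).2) := by
    rw [Finset.sum_sub_distrib]
    simp [hm]
  rw [hsum]
  have h2 : empiricalMean (logLoss C) (h ⟨s, hlt⟩) =
      ENNReal.ofReal (Real.log C - Real.log (h ⟨s, hlt⟩ 0).2) := by
    simp [empiricalMean, logLoss]
  rw [h2]
  exact ENNReal.ofReal_le_ofReal
    (Finset.single_le_sum (fun j _ => hterm j) (Finset.mem_univ (⟨s, hlt⟩ : Fin (t + 1))))

theorem integrable_log_meanWeight [SFinite ν] (hC : 1 ≤ C) (hsupp : SameSupport M r y t)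
    (h0 : ∀ x, initWeight M r x ≤ C)
    (h1 : ∀ s, 1 ≤ s → s ≤ t → ∀ x x', stepWeight M r y s x x' ≤ C)
    (hint : LogMarginalIntegrable M r y t 1) (N : ℕ) [NeZero N] {s : ℕ} (hs : s ≤ t)
    (j : Fin (s + 1)) :
    Integrable (fun h => Real.log (meanWeight (h j))) (smcLaw M r y N s) := by
  have hmean := measurable_empiricalMean (N := N) (measurable_logLoss (X := X) C)
  refine ⟨(Real.measurable_log.comp (measurable_meanWeight.comp
    (measurable_pi_apply j)).coe_nnreal_real).aestronglyMeasurable, ?_⟩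
  refine (lintegral_mono_ae (g := fun h => ENNReal.ofReal (Real.log C) +
    empiricalMean (logLoss C) (h j)) ?_).trans_lt ?_
  · filter_upwards [ae_weight_pos M r y N hsupp hs, ae_weight_le M r y h0 h1 N hs] with h hpos hle
    exact enorm_log_meanWeight_le hC (hpos j) (hle j)
  · rw [lintegral_add_left measurable_const, lintegral_smcLaw_eval M r y N hmean j]
    simp only [lintegral_const, measure_univ, mul_one]
    refine ENNReal.add_lt_top.2 ⟨ENNReal.ofReal_lt_top, ?_⟩
    refine (lintegral_empiricalMean_le_pow M r y N j (measurable_logLoss C)).trans_lt ?_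
    exact ENNReal.mul_lt_top (by simp) (lintegral_logLoss_proposalLaw_ne_top hsupp h0 h1 hint
      (by have := j.2; omega)).lt_top

theorem logFilterIntegrable_of_bounded [SFinite ν] (hC : 1 ≤ C) (hsupp : SameSupport M r y t)
    (h0 : ∀ x, initWeight M r x ≤ C)
    (h1 : ∀ s, 1 ≤ s → s ≤ t → ∀ x x', stepWeight M r y s x x' ≤ C)
    (hint : LogMarginalIntegrable M r y t 1) (N : ℕ) [NeZero N] : LogFilterIntegrable M r y t N :=
  integrable_log_meanWeight hC hsupp h0 h1 hint N le_rfl (Fin.last t)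

theorem logMarginalIntegrable_of_bounded [SFinite ν] (hC : 1 ≤ C) (hsupp : SameSupport M r y t)
    (h0 : ∀ x, initWeight M r x ≤ C)
    (h1 : ∀ s, 1 ≤ s → s ≤ t → ∀ x x', stepWeight M r y s x x' ≤ C)
    (hint : LogMarginalIntegrable M r y t 1) (N : ℕ) [NeZero N] {s : ℕ} (hs : s ≤ t) :
    LogMarginalIntegrable M r y s N := by
  refine (integrable_finsetSum Finset.univ fun j _ =>
    integrable_log_meanWeight hC hsupp h0 h1 hint N hs j).congr ?_
  filter_upwards [ae_meanWeight_pos M r y N hsupp hs] with h hh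
  exact (log_marginalEstimate hh).symm

theorem exists_setLIntegral_tail_le {E : Type*} [MeasurableSpace E] {μ : Measure E} {f : E → ℝ≥0∞}
    (hf : Measurable f) (hfin : ∫⁻ x, f x ∂μ ≠ ∞) {ε : ℝ≥0∞} (hε : 0 < ε) :
    ∀ᶠ K : ℕ in atTop, ∫⁻ x, {x | (K : ℝ≥0∞) < f x}.indicator f x ∂μ ≤ ε := by
  have h := tendsto_lintegral_of_dominated_convergence (μ := μ) (f := fun _ => 0)
    (F := fun (K : ℕ) x => {x | (K : ℝ≥0∞) < f x}.indicator f x) f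
    (fun K => hf.indicator (measurableSet_lt measurable_const hf))
    (fun K => ae_of_all _ fun x => Set.indicator_le_self _ _ _) hfin ?_
  · rw [lintegral_zero, ENNReal.tendsto_nhds_zero] at h
    exact h ε hε
  · filter_upwards [ae_lt_top hf hfin] with x hx
    refine tendsto_const_nhds.congr' ?_
    obtain ⟨n, hn⟩ := ENNReal.exists_nat_gt hx.ne
    filter_upwards [eventually_ge_atTop n] with K hK
    rw [Set.indicator_of_notMem]
    exact not_lt.2 (hn.le.trans (by exact_mod_cast hK))

/-- Bounded weights and a finite one-particle bound give uniform integrability. The negative part of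
`log p̂` is at most the sum over time of the mean logarithmic losses, and the tails of these are
dominated, uniformly in the number of particles, by those of the losses along the proposal. -/
theorem logNegUniformIntegrable_of_bounded [SigmaFinite ν] (hC : 1 ≤ C)
    (hsupp : SameSupport M r y t) (h0 : ∀ x, initWeight M r x ≤ C)
    (h1 : ∀ s, 1 ≤ s → s ≤ t → ∀ x x', stepWeight M r y s x x' ≤ C)
    (hint : LogMarginalIntegrable M r y t 1) {s : ℕ} (hs : s ≤ t) :
    LogNegUniformIntegrable M r y s := by
  intro ε hε
  have hdom : ∀ j : Fin (s + 1), ∃ A : ℝ≥0, ∀ᶠ N : ℕ in atTop, ∀ g : X × ℝ≥0 → ℝ≥0∞,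
      Measurable g → ∫⁻ h, empiricalMean g (h (Fin.last j)) ∂(smcLaw M r y N j) ≤
        A * ∫⁻ p, g p ∂(proposalLaw M r y j) := by
    intro j
    have hj := j.2
    refine exists_lintegral_empiricalMean_le M r y (C := C) (one_pos.trans_le hC)
      (fun N hN i hi => ?_) (fun i hi => ?_)
    · have : NeZero N := ⟨hN⟩
      filter_upwards [ae_weight_le M r y h0 h1 N (s := i) (by omega)] with h hh
      exact hh _
    · rw [lintegral_weight_weightedLaw M r y hsupp (by omega)]
      exact marginalLikelihood_ne_zero M r y hsupp (by omega)
  choose A hA using hdom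
  have hε' : ∀ j, (0 : ℝ≥0∞) < ε / (2 * (s + 1) * (A j + 1)) := fun j => by
    refine ENNReal.div_pos (by exact_mod_cast hε.ne') ?_
    exact ENNReal.mul_ne_top (ENNReal.mul_ne_top (by simp) (by simp)) (by simp)
  have htail : ∀ j : Fin (s + 1), ∀ᶠ K : ℕ in atTop,
      ∫⁻ p, {p | (K : ℝ≥0∞) < logLoss C p}.indicator (logLoss C) p ∂(proposalLaw M r y j) ≤
        ε / (2 * (s + 1) * (A j + 1)) := fun j =>
    exists_setLIntegral_tail_le (measurable_logLoss C)
      (lintegral_logLoss_proposalLaw_ne_top hsupp h0 h1 hint (by have := j.2; omega)) (hε' j)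
  obtain ⟨K, hK⟩ := (eventually_all.2 htail).exists
  -- The mean losses, truncated at `K`, add up to at most `(s + 1) * K`. Where the negative part of
  -- `log p̂` exceeds twice that level, it is therefore at most twice the sum of the tails.
  refine ⟨2 * ((s + 1) * K), ?_⟩
  filter_upwards [eventually_all.2 hA, eventually_ge_atTop 1] with N hAN hN1
  have : NeZero N := ⟨by omega⟩
  set ψ : X × ℝ≥0 → ℝ≥0∞ := {p | (K : ℝ≥0∞) < logLoss C p}.indicator (logLoss C) with hψ
  have hψm : Measurable ψ := (measurable_logLoss C).indicator
    (measurableSet_lt measurable_const (measurable_logLoss C))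
  have hem := measurable_empiricalMean (N := N) hψm
  have hlog : Measurable fun h : Fin (s + 1) → Generation X N => Real.log (marginalEstimate h) :=
    Real.measurable_log.comp measurable_marginalEstimate
  set S := {h : Fin (s + 1) → Generation X N |
    ((2 * ((s + 1) * K) : ℝ≥0) : ℝ) < -Real.log (marginalEstimate h)} with hS
  have hSm : MeasurableSet S := measurableSet_lt measurable_const hlog.neg
  calc ∫⁻ h in S, ENNReal.ofReal (-Real.log (marginalEstimate h)) ∂(smcLaw M r y N s)
      ≤ ∫⁻ h, 2 * ∑ j, empiricalMean ψ (h j) ∂(smcLaw M r y N s) := by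
        rw [← lintegral_indicator hSm]
        refine lintegral_mono_ae ?_
        filter_upwards [ae_weight_pos M r y N hsupp hs, ae_weight_le M r y h0 h1 N hs] with
          h hpos hle
        refine Set.indicator_apply_le' (fun hhS => ?_) fun _ => zero_le
        set x := ENNReal.ofReal (-Real.log (marginalEstimate h)) with hx
        set R := ∑ j, empiricalMean ψ (h j) with hR
        have hxle : x ≤ (s + 1) * K + R := by
          calc x ≤ ∑ j, ENNReal.ofReal (-Real.log (meanWeight (h j))) := by
                rw [hx, log_marginalEstimate fun j => meanWeight_pos (hpos j),
                  ← Finset.sum_neg_distrib]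
                exact Finset.le_sum_of_subadditive _ ENNReal.ofReal_zero.le
                  (fun a b => ENNReal.ofReal_add_le) _ _
            _ ≤ ∑ j, (K + empiricalMean ψ (h j)) := by
                refine Finset.sum_le_sum fun j _ => ?_
                refine (ofReal_neg_log_meanWeight_le hC (hpos j) (hle j)).trans ?_
                have hK1 : empiricalMean (fun p => K + ψ p) (h j) = K + empiricalMean ψ (h j) := by
                  simp only [empiricalMean, Finset.sum_add_distrib, ENNReal.add_div]
                  rw [Finset.sum_const, Finset.card_univ, Fintype.card_fin, nsmul_eq_mul, mul_comm,
                    ENNReal.mul_div_cancel_right (by exact_mod_cast NeZero.ne N) (by simp)]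
                rw [← hK1]
                refine empiricalMean_mono (fun p => ?_) _
                by_cases hp : (K : ℝ≥0∞) < logLoss C p
                · rw [hψ, Set.indicator_of_mem (by exact hp)]
                  exact le_add_self
                · exact le_add_right (not_lt.1 hp)
            _ = (s + 1) * K + R := by
                rw [Finset.sum_add_distrib]
                simp [hR]
        have hxgt : 2 * ((s + 1) * K) < x := by
          have h2 : ((2 * ((s + 1) * K) : ℝ≥0) : ℝ≥0∞) < x := by
            rw [hx, ← ENNReal.ofReal_coe_nnreal]
            exact (ENNReal.ofReal_lt_ofReal_iff_of_nonneg NNReal.zero_le_coe).2 hhS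
          simpa using h2
        have hKR : ((s : ℝ≥0∞) + 1) * K ≤ R := by
          have h2 := hxgt.le.trans hxle
          rw [two_mul] at h2
          exact (ENNReal.add_le_add_iff_left
            (ENNReal.mul_ne_top (by simp) (by simp))).1 h2
        calc x ≤ (s + 1) * K + R := hxle
          _ ≤ R + R := by gcongr
          _ = 2 * R := (two_mul R).symm
    _ = 2 * ∑ j, ∫⁻ h, empiricalMean ψ (h j) ∂(smcLaw M r y N s) := by
        rw [lintegral_const_mul _ (by fun_prop), lintegral_finsetSum _ fun j _ => by fun_prop]
    _ ≤ 2 * ∑ _j : Fin (s + 1), (ε : ℝ≥0∞) / (2 * (s + 1)) := by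
        gcongr with j
        rw [lintegral_smcLaw_eval M r y N hem j]
        refine (hAN j ψ hψm).trans ?_
        calc A j * ∫⁻ p, ψ p ∂(proposalLaw M r y j)
            ≤ (A j + 1) * (ε / (2 * (s + 1) * (A j + 1))) :=
              mul_le_mul' le_self_add (hK j)
          _ = ε / (2 * (s + 1)) := by
              rw [← mul_div_assoc, mul_comm, ENNReal.mul_div_mul_right _ _ (by simp) (by simp)]
    _ = ε := by
        rw [Finset.sum_const, Finset.card_univ, Fintype.card_fin, nsmul_eq_mul, ← mul_assoc]
        push_cast
        exact ENNReal.mul_div_cancel (by simp) (ENNReal.mul_ne_top (by simp) (by simp))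

end Bounded

/-! ### The filtering ELBO -/

section FilteringELBO

variable {M : StateSpaceModel X Y ν ρ} {r : Proposal X Y ν} {y : ℕ → Y} {t : ℕ}

theorem toReal_marginalLikelihood_pos [SigmaFinite ν]
    (hfin : ∀ s ≤ t, marginalLikelihood M y s ≠ ∞) (hsupp : SameSupport M r y t) {s : ℕ}
    (hs : s ≤ t) : 0 < (marginalLikelihood M y s).toReal :=
  ENNReal.toReal_pos (marginalLikelihood_ne_zero M r y hsupp hs) (hfin s hs)

theorem integral_log_marginalEstimate_le [SigmaFinite ν]
    (hfin : ∀ s ≤ t, marginalLikelihood M y s ≠ ∞) (hsupp : SameSupport M r y t) {s : ℕ}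
    (hs : s ≤ t) (N : ℕ) [NeZero N] (hint : LogMarginalIntegrable M r y s N) :
    ∫ h, Real.log (marginalEstimate h) ∂(smcLaw M r y N s) ≤
      Real.log (marginalLikelihood M y s).toReal :=
  integral_log_le_log measurable_marginalEstimate (ae_marginalEstimate_pos M r y N hsupp hs)
    (toReal_marginalLikelihood_pos hfin hsupp hs)
    (by rw [lintegral_marginalEstimate M r y N hsupp hs, ENNReal.ofReal_toReal (hfin s hs)]) hint

omit [MeasurableSpace X] in
theorem log_marginalEstimate_succ {N : ℕ} {h : Fin (t + 2) → Generation X N}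
    (hh : ∀ j, 0 < meanWeight (h j)) :
    Real.log (marginalEstimate h) =
      Real.log (marginalEstimate (Fin.init h : Fin (t + 1) → Generation X N)) +
        Real.log (filterEstimate h) := by
  rw [log_marginalEstimate hh, Fin.sum_univ_castSucc,
    log_marginalEstimate (h := (Fin.init h : Fin (t + 1) → Generation X N)) fun j => hh j.castSucc]
  rfl

theorem integrable_log_marginalEstimate_init [SFinite ν] (N : ℕ) [NeZero N]
    (hint : LogMarginalIntegrable M r y t N) :
    Integrable (fun h : Fin (t + 2) → Generation X N =>
      Real.log (marginalEstimate (Fin.init h : Fin (t + 1) → Generation X N)))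
      (smcLaw M r y N (t + 1)) :=
  (measurePreserving_init_smcLaw M r y N t).integrable_comp_of_integrable
    (g := fun h : Fin (t + 1) → Generation X N => Real.log (marginalEstimate h)) hint

theorem logMarginalIntegrable_succ [SFinite ν] (hsupp : SameSupport M r y (t + 1)) (N : ℕ)
    [NeZero N] (h1 : LogMarginalIntegrable M r y t N) (h2 : LogFilterIntegrable M r y (t + 1) N) :
    LogMarginalIntegrable M r y (t + 1) N := by
  refine ((integrable_log_marginalEstimate_init N h1).add h2).congr ?_
  filter_upwards [ae_meanWeight_pos M r y N hsupp le_rfl] with h hh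
  exact (log_marginalEstimate_succ hh).symm

theorem logFilterIntegrable_succ [SFinite ν] (hsupp : SameSupport M r y (t + 1)) (N : ℕ)
    [NeZero N] (h1 : LogMarginalIntegrable M r y t N) (h2 : LogMarginalIntegrable M r y (t + 1) N) :
    LogFilterIntegrable M r y (t + 1) N := by
  refine (h2.sub (integrable_log_marginalEstimate_init N h1)).congr ?_
  filter_upwards [ae_meanWeight_pos M r y N hsupp le_rfl] with h hh
  simp [log_marginalEstimate_succ hh]

/-- The two expectations in the filtering ELBO combine to that of the estimate of `p(y_{1:t})`. -/
theorem filteringELBO_succ [SFinite ν] (hsupp : SameSupport M r y (t + 1)) (N : ℕ) [NeZero N]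
    (h1 : LogMarginalIntegrable M r y t N) (h2 : LogFilterIntegrable M r y (t + 1) N) :
    filteringELBO M r y (t + 1) N =
      ∫ h, Real.log (marginalEstimate h) ∂(smcLaw M r y N (t + 1)) -
        Real.log (marginalLikelihood M y t).toReal := by
  have hinit : ∫ h, Real.log (marginalEstimate h) ∂(smcLaw M r y N t) =
      ∫ h, Real.log (marginalEstimate (Fin.init h : Fin (t + 1) → Generation X N))
        ∂(smcLaw M r y N (t + 1)) := by
    have hmp := measurePreserving_init_smcLaw M r y N t
    have hlog : Measurable fun h : Fin (t + 1) → Generation X N => Real.log (marginalEstimate h) :=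
      Real.measurable_log.comp measurable_marginalEstimate
    rw [← hmp.map_eq, integral_map hmp.measurable.aemeasurable hlog.aestronglyMeasurable]
  have hsum : ∫ h, Real.log (marginalEstimate h) ∂(smcLaw M r y N (t + 1)) =
      ∫ h, (Real.log (marginalEstimate (Fin.init h : Fin (t + 1) → Generation X N)) +
        Real.log (filterEstimate h)) ∂(smcLaw M r y N (t + 1)) := by
    refine integral_congr_ae ?_
    filter_upwards [ae_meanWeight_pos M r y N hsupp le_rfl] with h hh
    exact log_marginalEstimate_succ hh
  rw [hsum, integral_add (integrable_log_marginalEstimate_init N h1) h2, ← hinit, filteringELBO,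
    variationalGap, Nat.add_sub_cancel]
  ring

theorem log_filteringNormalizer_succ [SigmaFinite ν]
    (hfin : ∀ s ≤ t + 1, marginalLikelihood M y s ≠ ∞) (hsupp : SameSupport M r y (t + 1)) :
    Real.log (filteringNormalizer M y (t + 1)).toReal =
      Real.log (marginalLikelihood M y (t + 1)).toReal -
        Real.log (marginalLikelihood M y t).toReal := by
  rw [filteringNormalizer_succ M y
      (fun s hs => marginalLikelihood_ne_zero M r y hsupp (by omega))
      (fun s hs => hfin s (by omega)),
    ENNReal.toReal_div, Real.log_div (toReal_marginalLikelihood_pos hfin hsupp le_rfl).ne'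
      (toReal_marginalLikelihood_pos hfin hsupp (by omega)).ne']

theorem eventually_logMarginalIntegrable [SigmaFinite ν]
    (hfin : ∀ s ≤ t, marginalLikelihood M y s ≠ ∞) (hsupp : SameSupport M r y t) {s : ℕ}
    (hs : s ≤ t) (hUI : LogNegUniformIntegrable M r y s) :
    ∀ᶠ N : ℕ in atTop, LogMarginalIntegrable M r y s N := by
  obtain ⟨K, hK⟩ := hUI 1 one_pos
  filter_upwards [hK, eventually_ge_atTop 1] with N hKN hN
  have : NeZero N := ⟨by omega⟩
  refine integrable_log_of_lintegral_ne_top measurable_marginalEstimate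
    (ae_marginalEstimate_pos M r y N hsupp hs) ?_ (ne_top_of_le_ne_top ENNReal.coe_ne_top hKN)
  rw [lintegral_marginalEstimate M r y N hsupp hs]
  exact hfin s hs

/-- Consistency of the expected logarithm of the estimated marginal likelihood. -/
theorem tendsto_integral_log_marginalEstimate [SigmaFinite ν]
    (hfin : ∀ s ≤ t, marginalLikelihood M y s ≠ ∞) (hsupp : SameSupport M r y t)
    (hUI : LogNegUniformIntegrable M r y t) :
    Tendsto (fun N : ℕ => ∫ h, Real.log (marginalEstimate h) ∂(smcLaw M r y N t)) atTop
      (𝓝 (Real.log (marginalLikelihood M y t).toReal)) := by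
  have hmass : ∀ s ≤ t, ∫⁻ p, p.2 ∂(weightedLaw M r y s) = marginalLikelihood M y s := fun s hs =>
    lintegral_weight_weightedLaw M r y hsupp hs
  have hdev := tendsto_lintegral_sub_weightedMean M r y (t := t)
    (fun s hs => by rw [hmass s hs.le]; exact hfin s hs.le)
    (φ := fun p => (p.2 : ℝ≥0∞)) (by fun_prop) (by rw [hmass t le_rfl]; exact hfin t le_rfl)
  refine tendsto_integral_log (P := fun N => smcLaw M r y N t) (Z := fun N h => marginalEstimate h)
    ?_ (fun N => measurable_marginalEstimate) ?_ (toReal_marginalLikelihood_pos hfin hsupp le_rfl)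
    ?_ (hdev.congr' ?_) (eventually_logMarginalIntegrable hfin hsupp le_rfl hUI) hUI
  all_goals
    filter_upwards [eventually_ge_atTop 1] with N hN
    have : NeZero N := ⟨by omega⟩
  · infer_instance
  · exact ae_marginalEstimate_pos M r y N hsupp le_rfl
  · rw [lintegral_marginalEstimate M r y N hsupp le_rfl, ENNReal.ofReal_toReal (hfin t le_rfl)]
  · refine lintegral_congr fun h => ?_
    have h0 : 0 ≤ marginalEstimate h := Finset.prod_nonneg fun j _ => NNReal.zero_le_coe
    rw [ENNReal.ofReal_sub _ h0, ENNReal.ofReal_toReal (hfin t le_rfl), hmass t le_rfl,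
      ofReal_marginalEstimate]

/-- Convergence of the filtering ELBO under uniform integrability. -/
theorem tendsto_filteringELBO [SigmaFinite ν]
    (hfin : ∀ s ≤ t + 1, marginalLikelihood M y s ≠ ∞) (hsupp : SameSupport M r y (t + 1))
    (hint : ∀ᶠ N : ℕ in atTop,
      LogMarginalIntegrable M r y t N ∧ LogFilterIntegrable M r y (t + 1) N)
    (hUI : LogNegUniformIntegrable M r y (t + 1)) :
    Tendsto (fun N : ℕ => filteringELBO M r y (t + 1) N) atTop
      (𝓝 (Real.log (filteringNormalizer M y (t + 1)).toReal)) := by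
  rw [log_filteringNormalizer_succ hfin hsupp]
  refine ((tendsto_integral_log_marginalEstimate hfin hsupp hUI).sub_const _).congr' ?_
  filter_upwards [hint, eventually_ge_atTop 1] with N hN hN1
  have : NeZero N := ⟨by omega⟩
  exact (filteringELBO_succ hsupp N hN.1 hN.2).symm

end FilteringELBO

end SVMC

theorem theorem1 {X Y : Type*} [MeasurableSpace X] [MeasurableSpace Y]
    (ν : Measure X) [SigmaFinite ν] (ρ : Measure Y)
    (M : SVMC.StateSpaceModel X Y ν ρ) (r : SVMC.Proposal X Y ν)
    (y : ℕ → Y) (t : ℕ) (ht : 1 ≤ t)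
    (hfin : ∀ s ≤ t, SVMC.marginalLikelihood M y s ≠ ∞)
    (hsupp : SVMC.SameSupport M r y t) :
    -- nonnegative gap and lower bound, for every number of particles
    (∀ N : ℕ, 1 ≤ N → SVMC.LogMarginalIntegrable M r y (t - 1) N →
      0 ≤ SVMC.variationalGap M r y t N ∧
      (SVMC.LogFilterIntegrable M r y t N →
        SVMC.filteringELBO M r y t N ≤ Real.log (SVMC.filteringNormalizer M y t).toReal)) ∧
    -- convergence, under uniform integrability
    (SVMC.LogNegUniformIntegrable M r y (t - 1) → SVMC.LogNegUniformIntegrable M r y t →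
      (∀ᶠ N : ℕ in atTop,
        SVMC.LogMarginalIntegrable M r y (t - 1) N ∧ SVMC.LogFilterIntegrable M r y t N) ∧
      Tendsto (fun N : ℕ => SVMC.filteringELBO M r y t N) atTop
        (𝓝 (Real.log (SVMC.filteringNormalizer M y t).toReal))) ∧
    -- convergence for bounded weights with a finite one-particle bound
    (SVMC.BoundedWeights M r y t → SVMC.LogMarginalIntegrable M r y t 1 →
      (∀ N : ℕ, 1 ≤ N →
        SVMC.LogMarginalIntegrable M r y (t - 1) N ∧ SVMC.LogFilterIntegrable M r y t N) ∧
      Tendsto (fun N : ℕ => SVMC.filteringELBO M r y t N) atTop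
        (𝓝 (Real.log (SVMC.filteringNormalizer M y t).toReal))) := by
  obtain ⟨t, rfl⟩ : ∃ t', t = t' + 1 := ⟨t - 1, by omega⟩
  rw [Nat.add_sub_cancel]
  refine ⟨fun N hN hint => ?_, fun hUI hUI' => ?_, fun ⟨C, hC0, hC1⟩ hint => ?_⟩
  · have : NeZero N := ⟨by omega⟩
    refine ⟨?_, fun hint' => ?_⟩
    · have h := SVMC.integral_log_marginalEstimate_le hfin hsupp (Nat.le_succ t) N hint
      rw [SVMC.variationalGap, Nat.add_sub_cancel]
      linarith
    · rw [SVMC.filteringELBO_succ hsupp N hint hint', SVMC.log_filteringNormalizer_succ hfin hsupp]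
      have h := SVMC.integral_log_marginalEstimate_le hfin hsupp le_rfl N
        (SVMC.logMarginalIntegrable_succ hsupp N hint hint')
      linarith
  · have hint : ∀ᶠ N : ℕ in atTop,
        SVMC.LogMarginalIntegrable M r y t N ∧ SVMC.LogFilterIntegrable M r y (t + 1) N := by
      filter_upwards [SVMC.eventually_logMarginalIntegrable hfin hsupp (Nat.le_succ t) hUI,
        SVMC.eventually_logMarginalIntegrable hfin hsupp le_rfl hUI',
        eventually_ge_atTop 1] with N h1 h2 hN
      have : NeZero N := ⟨by omega⟩
      exact ⟨h1, SVMC.logFilterIntegrable_succ hsupp N h1 h2⟩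
    exact ⟨hint, SVMC.tendsto_filteringELBO hfin hsupp hint hUI'⟩
  · have hC : 1 ≤ max C 1 := le_max_right _ _
    have h0 : ∀ x, SVMC.initWeight M r x ≤ max C 1 := fun x => (hC0 x).trans (le_max_left _ _)
    have h1 : ∀ s, 1 ≤ s → s ≤ t + 1 → ∀ x x', SVMC.stepWeight M r y s x x' ≤ max C 1 :=
      fun s hs hst x x' => (hC1 s hs hst x x').trans (le_max_left _ _)
    have hints : ∀ N : ℕ, 1 ≤ N →
        SVMC.LogMarginalIntegrable M r y t N ∧ SVMC.LogFilterIntegrable M r y (t + 1) N := by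
      intro N hN
      have : NeZero N := ⟨by omega⟩
      exact ⟨SVMC.logMarginalIntegrable_of_bounded hC hsupp h0 h1 hint N (Nat.le_succ t),
        SVMC.logFilterIntegrable_of_bounded hC hsupp h0 h1 hint N⟩
    exact ⟨hints, SVMC.tendsto_filteringELBO hfin hsupp
      ((eventually_ge_atTop 1).mono hints)
      (SVMC.logNegUniformIntegrable_of_bounded hC hsupp h0 h1 hint le_rfl)⟩
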